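/- Let $m,p\ge 1$, $n=m+p$, and let $\Lambda=\mathrm{diag}(\lambda_1,\dots,\lambda_n)\in C^1([0,+\infty)\times[0,1])^{n\times n}$ with $\Lambda,\partial_x\Lambda$ bounded. Assume that for some $\epsilon>0$ and all $t\ge 0$, $x\in[0,1]$, $$\lambda_1<\dots<\lambda_m<-\epsilon<0<\epsilon<\lambda_{m+1}<\dots<\lambda_n,\qquad \lambda_{i+1}-\lambda_i>\epsilon\quad(1\le i\le n-1).$$ Write $y=(y_-,y_+)\in\mathbb R^m\times\mathbb R^p$. For bounded continuous $M,G:[0,+\infty)\times[0,1]\to\mathbb R^{n\times n}$ and $Q:[0,+\infty)\to\mathbb R^{p\times m}$, and for $F\in L^\infty((0,+\infty)\times(0,1))^{m\times n}$, let $(M,G,F,Q)$ denote the system $$\begin{cases}\partial_t y(t,x)+\Lambda(t,x)\partial_x y(t,x)=M(t,x)y(t,x)+G(t,x)y(t,0),\\ y_-(t,1)=\int_0^1F(t,\xi)y(t,\xi)\,d\xi,\qquad y_+(t,0)=Q(t)y_-(t,0),\\ y(t^0,x)=y^0(x),\end{cases}\qquad t>t^0\ge 0,\ x\in(0,1).$$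 For $t^0\ge0$ and $y^0\in L^2(0,1)^n$, its broad solution is the function $y\in C^0([t^0,t^0+T'];L^2(0,1)^n)\cap C^0([0,1];L^2(t^0,t^0+T')^n)$ (for all $T'>0$) that satisfies, for a.e. $(t,x)\in(t^0,+\infty)\times(0,1)$ and all $i$, the equation integrated along the characteristic $\chi_i$ (where $\partial_s\chi_i(s)=\lambda_i(s,\chi_i(s))$, $\chi_i(t)=x$) from its entry into $[t^0,+\infty)\times[0,1]$ up to time $t$, starting from the value that the boundary or initial condition prescribes at the entry point. For $T>0$, the system $(M,G,F,Q)$ is called finite-time stable with settling time $T$ if its broad solutions satisfy (i) $y(t^0+T,\cdot)=0$ for every $t^0\ge0$ and $y^0\in L^2(0,1)^n$; (ii) for every $\varepsilon>0$ there is $\delta>0$ such that, for every $t^0\ge 0$ and $y^0\in L^2(0,1)^n$, $\|y^0\|_{L^2}\le\delta$ implies $\|y(t,\cdot)\|_{L^2}\le\varepsilon$ for all $t\ge t^0$. Let $Q^1:[0,+\infty)\to\mathbb R^{p\times m}$, $G^2_{--}:[0,+\infty)\times[0,1]\to\mathbb R^{m\times m}$ and $G^2_{+-}:[0,+\infty)\times[0,1]\to\mathbb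 R^{p\times m}$ be bounded and continuous, with $G^2_{--}$ strictly lower triangular, and set $$G^2=\begin{pmatrix}G^2_{--}&0\\ G^2_{+-}&0\end{pmatrix},\qquad G^3=\begin{pmatrix}0&0\\ G^2_{+-}&0\end{pmatrix}.$$ **Proposition.** There exists $F^2\in L^\infty((0,+\infty)\times(0,1))^{m\times n}$ such that, for every $T>0$, if $(0,G^3,0,Q^1)$ is finite-time stable with settling time $T$, then $(0,G^2,F^2,Q^1)$ is finite-time stable with settling time $T$. -/

import Mathlib

open Set MeasureTheory Filter Topology
open scoped ENNReal

/-- The state space `ℝⁿ = ℝᵐ × ℝᵖ`, with the Euclidean norm. The coordinates `Sum.inl i` form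
`y₋` (negative speeds), the coordinates `Sum.inr k` form `y₊` (positive speeds). -/
abbrev HypState (m p : ℕ) : Type := EuclideanSpace ℝ (Fin m ⊕ Fin p)

/-- The closed space-time domain `[0,+∞) × [0,1]`. -/
def closedStrip : Set (ℝ × ℝ) := Ici (0 : ℝ) ×ˢ Icc (0 : ℝ) 1

/-- `C⁰([0,+∞) × [0,1]) ∩ L^∞((0,+∞) × (0,1))` for matrix-valued functions. -/
def IsBoundedContinuousMatrix {ι κ : Type} (A : ℝ → ℝ → Matrix ι κ ℝ) : Prop :=
  ∀ i j, ContinuousOn (fun q : ℝ × ℝ => A q.1 q.2 i j) closedStrip ∧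
    ∃ C : ℝ, ∀ t x : ℝ, 0 ≤ t → x ∈ Icc (0 : ℝ) 1 → |A t x i j| ≤ C

/-- `C⁰([0,+∞)) ∩ L^∞(0,+∞)` for matrix-valued functions of time. -/
def IsBoundedContinuousMatrixTime {ι κ : Type} (A : ℝ → Matrix ι κ ℝ) : Prop :=
  ∀ i j, ContinuousOn (fun t : ℝ => A t i j) (Ici 0) ∧
    ∃ C : ℝ, ∀ t : ℝ, 0 ≤ t → |A t i j| ≤ C

/-- `L^∞((0,+∞) × (0,1))` for matrix-valued functions. -/
def IsLInftyMatrix {ι κ : Type} (A : ℝ → ℝ → Matrix ι κ ℝ) : Prop :=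
  ∀ i j, MemLp (fun q : ℝ × ℝ => A q.1 q.2 i j) ∞
    (volume.restrict (Ioi (0 : ℝ) ×ˢ Ioo (0 : ℝ) 1))

/-- The standing assumptions on `Λ = diag(λ₁, …, λₙ)`: every `λᵢ` is `C¹` on `[0,+∞) × [0,1]`,
`Λ` and `∂Λ/∂x` are bounded there, and for some `ε > 0` one has
`λ₁ < ⋯ < λₘ < -ε < 0 < ε < λₘ₊₁ < ⋯ < λₙ` with consecutive gaps larger than `ε`
(the gap between `λₘ` and `λₘ₊₁` is automatic). -/
structure AdmissibleSpeeds {m p : ℕ} (lam : ℝ → ℝ → Fin m ⊕ Fin p → ℝ) : Prop where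
  contDiff : ∀ i, ContDiffOn ℝ 1 (fun q : ℝ × ℝ => lam q.1 q.2 i) closedStrip
  bounded : ∃ R : ℝ, ∀ i, ∀ t x : ℝ, 0 ≤ t → x ∈ Icc (0 : ℝ) 1 →
    |lam t x i| ≤ R ∧ |derivWithin (fun x' => lam t x' i) (Icc 0 1) x| ≤ R
  separated : ∃ ε : ℝ, 0 < ε ∧ ∀ t x : ℝ, 0 ≤ t → x ∈ Icc (0 : ℝ) 1 →
    (∀ i : Fin m, lam t x (Sum.inl i) < -ε) ∧
    (∀ k : Fin p, ε < lam t x (Sum.inr k)) ∧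
    (∀ i j : Fin m, i < j → ε < lam t x (Sum.inl j) - lam t x (Sum.inl i)) ∧
    (∀ k l : Fin p, k < l → ε < lam t x (Sum.inr l) - lam t x (Sum.inr k))

/-- The end of `[0,1]` through which the characteristics of the `i`-th equation enter:
`x = 1` for negative speeds, `x = 0` for positive speeds. -/
def entryPoint {m p : ℕ} : Fin m ⊕ Fin p → ℝ
  | Sum.inl _ => 1
  | Sum.inr _ => 0

/-- `c : [s₀, t] → [0,1]` is the part inside `[t⁰, t] × [0,1]` of the characteristic `χ(·; t, x)` of
the scalar speed `l` that passes through `x` at time `t`. Backwards in time it is followed either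
down to the initial time `t⁰` or up to the time where it entered `[0,1]` at the end point `e`;
so `s₀ = max {t⁰, sⁱⁿ(t, x)}`. -/
structure IsBackwardCharacteristic (l : ℝ → ℝ → ℝ) (e t0 t x s0 : ℝ) (c : ℝ → ℝ) : Prop where
  time_mem : s0 ∈ Icc t0 t
  inside : ∀ s ∈ Icc s0 t, c s ∈ Icc (0 : ℝ) 1
  ode : ∀ s ∈ Icc s0 t, HasDerivWithinAt c (l s (c s)) (Icc s0 t) s
  final : c t = x
  start : s0 = t0 ∨ c s0 = e

/-- `y ∈ C⁰([t⁰, t⁰+T]; L²(0,1)ⁿ) ∩ C⁰([0,1]; L²(t⁰, t⁰+T)ⁿ)` for all `T > 0`, for a jointly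
(almost everywhere) measurable function `y` all of whose sections are the right ones. In particular
`y (·, 0)` is the trace of `y` at `x = 0`. -/
structure HasBroadRegularity {m p : ℕ} (t0 : ℝ) (y : ℝ → ℝ → HypState m p) : Prop where
  measurable : AEStronglyMeasurable (fun q : ℝ × ℝ => y q.1 q.2)
    (volume.restrict (Ioi t0 ×ˢ Ioo (0 : ℝ) 1))
  memLp_space : ∀ t, t0 ≤ t → MemLp (y t) 2 (volume.restrict (Ioo (0 : ℝ) 1))
  continuous_time : ∀ t, t0 ≤ t →
    Tendsto (fun s => eLpNorm (fun x => y s x - y t x) 2 (volume.restrict (Ioo (0 : ℝ) 1)))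
      (𝓝[Ici t0] t) (𝓝 0)
  memLp_time : ∀ T > 0, ∀ x ∈ Icc (0 : ℝ) 1,
    MemLp (fun t => y t x) 2 (volume.restrict (Ioo t0 (t0 + T)))
  continuous_space : ∀ T > 0, ∀ x ∈ Icc (0 : ℝ) 1,
    Tendsto (fun x' => eLpNorm (fun t => y t x' - y t x) 2 (volume.restrict (Ioo t0 (t0 + T))))
      (𝓝[Icc 0 1] x) (𝓝 0)

/-- The boundary values prescribed to the incoming components at time `s`:
`y₋(s,1) = ∫₀¹ F(s,ξ) y(s,ξ) dξ` and `y₊(s,0) = Q(s) y₋(s,0)`. -/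
noncomputable def boundaryValue {m p : ℕ}
    (F : ℝ → ℝ → Matrix (Fin m) (Fin m ⊕ Fin p) ℝ) (Q : ℝ → Matrix (Fin p) (Fin m) ℝ)
    (y : ℝ → ℝ → HypState m p) (s : ℝ) : Fin m ⊕ Fin p → ℝ
  | Sum.inl i => ∑ j, ∫ ξ in (0 : ℝ)..1, F s ξ i j * y s ξ j
  | Sum.inr k => ∑ j : Fin m, Q s k j * y s 0 (Sum.inl j)

/-- `y` is a broad solution (solution along the characteristics) on `(t⁰,+∞) × (0,1)` of the
system `(M, G, F, Q)`:
`∂ₜy + Λ ∂ₓy = M y + G y(t,0)`, `y₋(t,1) = ∫₀¹ F(t,ξ) y(t,ξ) dξ`, `y₊(t,0) = Q(t) y₋(t,0)`,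
`y(t⁰,·) = y⁰`. The system, integrated along the characteristics from their entry into
`[t⁰,+∞) × [0,1]`, holds almost everywhere. -/
structure IsBroadSolution {m p : ℕ} (lam : ℝ → ℝ → Fin m ⊕ Fin p → ℝ)
    (M G : ℝ → ℝ → Matrix (Fin m ⊕ Fin p) (Fin m ⊕ Fin p) ℝ)
    (F : ℝ → ℝ → Matrix (Fin m) (Fin m ⊕ Fin p) ℝ) (Q : ℝ → Matrix (Fin p) (Fin m) ℝ)
    (t0 : ℝ) (y0 : ℝ → HypState m p) (y : ℝ → ℝ → HypState m p) : Prop where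
  regularity : HasBroadRegularity t0 y
  equation : ∀ᵐ q : ℝ × ℝ ∂(volume.restrict (Ioi t0 ×ˢ Ioo (0 : ℝ) 1)),
    ∀ (i : Fin m ⊕ Fin p) (s0 : ℝ) (c : ℝ → ℝ),
      IsBackwardCharacteristic (fun s z => lam s z i) (entryPoint i) t0 q.1 q.2 s0 c →
      y q.1 q.2 i =
        (if t0 < s0 then boundaryValue F Q y s0 i else y0 (c t0) i)
        + (∑ j, ∫ s in s0..q.1, M s (c s) i j * y s (c s) j)
        + (∑ j, ∫ s in s0..q.1, G s (c s) i j * y s 0 j)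

/-- Finite-time stability with settling time `T` of the system `(M, G, F, Q)`: for all `t⁰ ≥ 0` and
`y⁰ ∈ L²(0,1)ⁿ` the solution vanishes at time `t⁰ + T` (finite-time global attractor), and for every
`ε > 0` there is `δ > 0`, independent of `t⁰` and `y⁰`, such that `‖y⁰‖ ≤ δ` implies
`‖y(t,·)‖ ≤ ε` for all `t ≥ t⁰` (uniform stability). The norms are those of `L²(0,1)ⁿ`. -/
def FiniteTimeStable {m p : ℕ} (lam : ℝ → ℝ → Fin m ⊕ Fin p → ℝ)
    (M G : ℝ → ℝ → Matrix (Fin m ⊕ Fin p) (Fin m ⊕ Fin p) ℝ)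
    (F : ℝ → ℝ → Matrix (Fin m) (Fin m ⊕ Fin p) ℝ) (Q : ℝ → Matrix (Fin p) (Fin m) ℝ)
    (T : ℝ) : Prop :=
  (∀ t0 : ℝ, 0 ≤ t0 → ∀ y0 : ℝ → HypState m p, MemLp y0 2 (volume.restrict (Ioo (0 : ℝ) 1)) →
    ∀ y, IsBroadSolution lam M G F Q t0 y0 y →
      y (t0 + T) =ᵐ[volume.restrict (Ioo (0 : ℝ) 1)] 0) ∧
  (∀ ε : ℝ, 0 < ε → ∃ δ : ℝ, 0 < δ ∧
    ∀ t0 : ℝ, 0 ≤ t0 → ∀ y0 : ℝ → HypState m p, MemLp y0 2 (volume.restrict (Ioo (0 : ℝ) 1)) →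
      eLpNorm y0 2 (volume.restrict (Ioo (0 : ℝ) 1)) ≤ ENNReal.ofReal δ →
      ∀ y, IsBroadSolution lam M G F Q t0 y0 y →
        ∀ t, t0 ≤ t → eLpNorm (y t) 2 (volume.restrict (Ioo (0 : ℝ) 1)) ≤ ENNReal.ofReal ε)

/-!
Subtract from the negative components of `y` the part produced by the trace: let `w i` solve
`∂ₜ(w i) + λᵢ ∂ₓ(w i) = ∑ j, G²₋₋ i j (t, x) * y(t, 0) j` with `w i (t, 0) = 0`, and put
`z = y - w`. Since `z i` is constant along the `i`-th characteristics and has the same trace at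
`x = 0` as `y`, the value `z(t, x) i` is the trace `y(τ, 0) i` at the time `τ` at which the `i`-th
characteristic through `(t, x)` reaches `x = 0`. Taking `τ` as the variable of integration gives
`w(s, ·) = -K(s) z(s, ·)` for an integral operator `K(s)` with bounded, strictly triangular, hence
nilpotent, kernel. So `y = (1 - K) z` at each time, which is inverted by `z = (1 + R) y` with the
resolvent `R` of `K`. The feedback `F² = -R(·, 1, ·)` is the one that makes `z₋(s, 1) = 0`: then
`z` solves `(0, G³, 0, Q¹)`, and stability is carried over by the uniform bounds on `K` and `R`.
-/

open scoped NNReal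

section IntegralCurve

variable {E : Type*} [NormedAddCommGroup E] [NormedSpace ℝ E] {v : ℝ → E → E} {K : ℝ≥0}

theorem exists_isIntegralCurveOn_Ioo [CompleteSpace E] {R : ℝ≥0}
    (hc : ∀ x, Continuous fun t => v t x) (hl : ∀ t, LipschitzWith K (v t))
    (hb : ∀ t x, ‖v t x‖ ≤ R) (t r : ℝ) (x : E) :
    ∃ c : ℝ → E, c t = x ∧ IsIntegralCurveOn c v (Ioo (t - r) (t + r)) := by
  rcases le_or_gt r 0 with hr | hr
  · exact ⟨fun _ => x, rfl, fun s hs => absurd (hs.1.trans hs.2) (by linarith)⟩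
  have hpl : IsPicardLindelof v (⟨t, by linarith, by linarith⟩ : Icc (t - r) (t + r)) x
      (R * r.toNNReal) 0 R K :=
    { lipschitzOnWith := fun s _ => (hl s).lipschitzOnWith
      continuousOn := fun y _ => (hc y).continuousOn
      norm_le := fun s _ y _ => hb s y
      mul_max_le := by simp [hr.le] }
  obtain ⟨c, hct, hode⟩ := hpl.exists_eq_forall_mem_Icc_hasDerivWithinAt₀
  exact ⟨c, hct, fun s hs => (hode s (Ioo_subset_Icc_self hs)).mono Ioo_subset_Icc_self⟩

theorem exists_isIntegralCurve [CompleteSpace E] {R : ℝ≥0}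
    (hc : ∀ x, Continuous fun t => v t x) (hl : ∀ t, LipschitzWith K (v t))
    (hb : ∀ t x, ‖v t x‖ ≤ R) (t : ℝ) (x : E) :
    ∃ c : ℝ → E, c t = x ∧ IsIntegralCurve c v := by
  choose c hct hode using fun r => exists_isIntegralCurveOn_Ioo hc hl hb t r x
  have hderiv : ∀ r, ∀ s ∈ Ioo (t - r) (t + r), HasDerivAt (c r) (v s (c r s)) s :=
    fun r s hs => (hode r s hs).hasDerivAt (Ioo_mem_nhds hs.1 hs.2)
  have agree : ∀ r s, |s - t| < r → c (|s - t| + 1) s = c r s := by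
    intro r s hs
    set r' := min (|s - t| + 1) r
    have hr' : |s - t| < r' := lt_min (lt_add_one _) hs
    have hr0 : 0 < r' := (abs_nonneg _).trans_lt hr'
    have hsub : ∀ q, r' ≤ q → Ioo (t - r') (t + r') ⊆ Ioo (t - q) (t + q) :=
      fun q hq => Ioo_subset_Ioo (by linarith) (by linarith)
    refine ODE_solution_unique_of_mem_Ioo (s := fun _ => univ) (t₀ := t)
      (fun τ _ => (hl τ).lipschitzOnWith) ⟨by linarith, by linarith⟩
      (fun τ hτ => ⟨hderiv _ τ (hsub _ (min_le_left _ _) hτ), trivial⟩)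
      (fun τ hτ => ⟨hderiv _ τ (hsub _ (min_le_right _ _) hτ), trivial⟩)
      (by rw [hct, hct]) ?_
    constructor <;> linarith [abs_lt.1 hr']
  refine ⟨fun s => c (|s - t| + 1) s, hct _, fun s => ?_⟩
  have hlt := lt_add_one |s - t|
  have hnear : (fun s => c (|s - t| + 1) s) =ᶠ[𝓝 s] c (|s - t| + 1) :=
    ((continuous_id.sub continuous_const).abs.continuousAt.eventually_lt_const hlt).mono
      fun s' hs' => agree _ s' hs'
  exact (hderiv _ s (by constructor <;> linarith [abs_lt.1 hlt])).congr_of_eventuallyEq hnear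

theorem dist_le_of_isIntegralCurve {c d : ℝ → E} (hl : ∀ t, LipschitzWith K (v t))
    (hc : IsIntegralCurve c v) (hd : IsIntegralCurve d v) (s t : ℝ) :
    dist (c s) (d s) ≤ dist (c t) (d t) * Real.exp (K * |s - t|) := by
  wlog h : t ≤ s generalizing v c d s t
  · have key := this (v := fun r x => -v (-r) x) (c := fun r => c (-r)) (d := fun r => d (-r))
      (fun r => (hl (-r)).neg) (fun r => by
        simpa [Function.comp_def] using (hc (-r)).scomp r (hasDerivAt_neg r))
      (fun r => by
        simpa [Function.comp_def] using (hd (-r)).scomp r (hasDerivAt_neg r))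
      (-s) (-t) (by linarith)
    simpa only [neg_neg, ← neg_sub', abs_neg] using key
  rw [abs_of_nonneg (sub_nonneg.2 h)]
  exact dist_le_of_trajectories_ODE hl hc.continuous.continuousOn
    (fun r _ => (hc r).hasDerivWithinAt) hd.continuous.continuousOn
    (fun r _ => (hd r).hasDerivWithinAt) le_rfl s ⟨h, le_rfl⟩

end IntegralCurve

/-- A bounded time-dependent vector field that is continuous in time and Lipschitz in space,
uniformly in time; its flow is globally defined. -/
structure LipschitzField (E : Type*) [NormedAddCommGroup E] where
  velocity : ℝ → E → E
  lip : ℝ≥0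
  bound : ℝ≥0
  continuous_velocity : ∀ x, Continuous fun t => velocity t x
  lipschitzWith_velocity : ∀ t, LipschitzWith lip (velocity t)
  norm_velocity_le : ∀ t x, ‖velocity t x‖ ≤ bound

namespace LipschitzField

variable {E : Type*} [NormedAddCommGroup E] [NormedSpace ℝ E] [CompleteSpace E]
  (f : LipschitzField E)

/-- `f.flow s t x` is the position at time `s` of the integral curve through `x` at time `t`,
the characteristic `χ(s; t, x)`. -/
noncomputable def flow (s t : ℝ) (x : E) : E :=
  (exists_isIntegralCurve f.continuous_velocity f.lipschitzWith_velocity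
    f.norm_velocity_le t x).choose s

@[simp] theorem flow_self (t : ℝ) (x : E) : f.flow t t x = x :=
  (exists_isIntegralCurve f.continuous_velocity f.lipschitzWith_velocity
    f.norm_velocity_le t x).choose_spec.1

theorem isIntegralCurve_flow (t : ℝ) (x : E) :
    IsIntegralCurve (fun s => f.flow s t x) f.velocity :=
  (exists_isIntegralCurve f.continuous_velocity f.lipschitzWith_velocity
    f.norm_velocity_le t x).choose_spec.2

theorem eq_flow {a t : ℝ} {c : ℝ → E} (hc : IsIntegralCurveOn c f.velocity (Icc a t)) {s : ℝ}
    (hs : s ∈ Icc a t) : c s = f.flow s t (c t) := by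
  refine ODE_solution_unique_of_mem_Icc_left (v := f.velocity) (s := fun _ => univ)
    (fun r _ => (f.lipschitzWith_velocity r).lipschitzOnWith) hc.continuousOn (fun r hr => ?_)
    (fun _ _ => trivial) (f.isIntegralCurve_flow t (c t)).continuous.continuousOn
    (fun r _ => (f.isIntegralCurve_flow t (c t) r).hasDerivWithinAt) (fun _ _ => trivial)
    (f.flow_self t (c t)).symm hs
  exact ((hc r (Ioc_subset_Icc_self hr)).mono (Icc_subset_Icc_right hr.2)).mono_of_mem_nhdsWithin
    (Icc_mem_nhdsLE hr.1)

theorem flow_flow (r s t : ℝ) (x : E) : f.flow r s (f.flow s t x) = f.flow r t x :=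
  congrFun (ODE_solution_unique_univ (v := f.velocity) (s := fun _ => univ) (t₀ := s)
    (fun r => (f.lipschitzWith_velocity r).lipschitzOnWith)
    (fun r => ⟨f.isIntegralCurve_flow s _ r, trivial⟩)
    (fun r => ⟨f.isIntegralCurve_flow t x r, trivial⟩) (f.flow_self _ _)) r

theorem flow_injective (s t : ℝ) : Function.Injective (f.flow s t) :=
  Function.LeftInverse.injective (g := f.flow t s) fun x => by rw [flow_flow, flow_self]

theorem dist_flow_le (s t : ℝ) (x x' : E) :
    dist (f.flow s t x) (f.flow s t x') ≤ dist x x' * Real.exp (f.lip * |s - t|) := by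
  simpa using dist_le_of_isIntegralCurve f.lipschitzWith_velocity (f.isIntegralCurve_flow t x)
    (f.isIntegralCurve_flow t x') s t

theorem dist_le_dist_flow (s t : ℝ) (x x' : E) :
    dist x x' ≤ dist (f.flow s t x) (f.flow s t x') * Real.exp (f.lip * |s - t|) := by
  simpa [flow_flow, abs_sub_comm] using f.dist_flow_le t s (f.flow s t x) (f.flow s t x')

theorem lipschitzWith_flow_time (t : ℝ) (x : E) :
    LipschitzWith f.bound fun s => f.flow s t x :=
  lipschitzWith_of_nnnorm_deriv_le (fun s => (f.isIntegralCurve_flow t x s).differentiableAt)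
    fun s => by
      rw [(f.isIntegralCurve_flow t x s).deriv]
      exact f.norm_velocity_le _ _

theorem continuous_flow : Continuous fun q : ℝ × ℝ × E => f.flow q.1 q.2.1 q.2.2 := by
  refine continuous_prod_of_continuous_lipschitzWith _ f.bound (fun s => ?_)
    fun q => f.lipschitzWith_flow_time q.1 q.2
  refine continuous_iff_continuousAt.2 fun ⟨t, x⟩ => tendsto_iff_dist_tendsto_zero.2 ?_
  have hle : ∀ q : ℝ × E, dist (f.flow s q.1 q.2) (f.flow s t x) ≤
      (f.bound * dist t q.1 + dist q.2 x) * Real.exp (f.lip * |s - t|) := by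
    rintro ⟨t', x'⟩
    rw [← f.flow_flow s t t' x']
    refine (f.dist_flow_le s t _ _).trans ?_
    gcongr
    refine (dist_triangle _ x' _).trans (add_le_add_left ?_ _)
    simpa using (f.lipschitzWith_flow_time t' x').dist_le_mul t t'
  have hcont : Continuous fun q : ℝ × E =>
      (f.bound * dist t q.1 + dist q.2 x) * Real.exp (f.lip * |s - t|) := by fun_prop
  exact squeeze_zero (fun _ => dist_nonneg) hle (by simpa using hcont.tendsto (t, x))

theorem strictMono_flow (f : LipschitzField ℝ) (s t : ℝ) : StrictMono (f.flow s t) := by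
  intro x x' hx
  by_contra! hle
  have hcont : Continuous fun r => f.flow r t x' - f.flow r t x :=
    (f.isIntegralCurve_flow t x').continuous.sub (f.isIntegralCurve_flow t x).continuous
  obtain ⟨r, hr⟩ := mem_range_of_exists_le_of_exists_ge (c := 0) hcont
    ⟨s, sub_nonpos.2 hle⟩ ⟨t, by simpa using hx.le⟩
  exact hx.ne' (f.flow_injective r t (sub_eq_zero.1 hr))

end LipschitzField

/-- A Lipschitz field on the line whose velocity is negative and bounded away from `0`, the model
for the speeds `λ₁, …, λₘ`. -/
structure NegativeField extends LipschitzField ℝ where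
  gap : ℝ≥0
  gap_pos : 0 < gap
  velocity_le : ∀ t x, velocity t x ≤ -gap

namespace NegativeField

variable (f : NegativeField)

theorem flow_sub_flow_le {s s' : ℝ} (h : s ≤ s') (t x : ℝ) :
    f.flow s' t x - f.flow s t x ≤ -f.gap * (s' - s) :=
  image_sub_le_mul_sub_of_deriv_le
    (fun r => (f.isIntegralCurve_flow t x r).differentiableAt)
    (fun r => by rw [(f.isIntegralCurve_flow t x r).deriv]; exact f.velocity_le _ _) h

theorem gap_mul_dist_le (s s' t x : ℝ) :
    f.gap * dist s s' ≤ dist (f.flow s t x) (f.flow s' t x) := by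
  wlog h : s' ≤ s generalizing s s'
  · simpa only [dist_comm] using this s' s (le_of_not_ge h)
  rw [Real.dist_eq, Real.dist_eq, abs_of_nonneg (sub_nonneg.2 h)]
  linarith [f.flow_sub_flow_le h t x, neg_le_abs (f.flow s t x - f.flow s' t x)]

theorem strictAnti_flow_time (t x : ℝ) : StrictAnti fun s => f.flow s t x := fun s s' h => by
  have := mul_pos (NNReal.coe_pos.2 f.gap_pos) (sub_pos.2 h)
  linarith [f.flow_sub_flow_le h.le t x]

theorem exists_flow_eq (a t x : ℝ) : ∃ s, f.flow s t x = a := by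
  have hgap := NNReal.coe_pos.2 f.gap_pos
  set d := |x - a| / f.gap
  have hd : f.gap * d = |x - a| := mul_div_cancel₀ _ hgap.ne'
  have hd0 : 0 ≤ d := by positivity
  have hpast := f.flow_sub_flow_le (s := t - d) (s' := t) (by linarith) t x
  have hfuture := f.flow_sub_flow_le (s := t) (s' := t + d) (by linarith) t x
  rw [f.flow_self] at hpast hfuture
  exact mem_range_of_exists_le_of_exists_ge (f.isIntegralCurve_flow t x).continuous
    ⟨t + d, by linarith [le_abs_self (x - a)]⟩ ⟨t - d, by linarith [neg_abs_le (x - a)]⟩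

/-- `f.hit a t x` is the time at which the characteristic through `x` at time `t` is at position
`a`. -/
noncomputable def hit (a t x : ℝ) : ℝ := (f.exists_flow_eq a t x).choose

@[simp] theorem flow_hit (a t x : ℝ) : f.flow (f.hit a t x) t x = a :=
  (f.exists_flow_eq a t x).choose_spec

theorem hit_eq {a s t x : ℝ} (h : f.flow s t x = a) : f.hit a t x = s :=
  (f.strictAnti_flow_time t x).injective (by simp only [flow_hit, h])

@[simp] theorem hit_self (t x : ℝ) : f.hit x t x = t := f.hit_eq (f.flow_self t x)

theorem hit_flow (a s t x : ℝ) : f.hit a s (f.flow s t x) = f.hit a t x :=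
  f.hit_eq (by rw [f.flow_flow, f.flow_hit])

theorem hit_hit (a b t x : ℝ) : f.hit b (f.hit a t x) a = f.hit b t x := by
  simpa only [flow_hit] using f.hit_flow b (f.hit a t x) t x

theorem flow_hit_base (a s t x : ℝ) : f.flow s (f.hit a t x) a = f.flow s t x := by
  simpa only [flow_hit] using f.flow_flow s (f.hit a t x) t x

theorem lt_hit_iff {a s t x : ℝ} : s < f.hit a t x ↔ a < f.flow s t x := by
  simpa using (f.strictAnti_flow_time t x).lt_iff_gt (a := f.hit a t x) (b := s) |>.symm

theorem hit_lt_iff {a s t x : ℝ} : f.hit a t x < s ↔ f.flow s t x < a := by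
  simpa using (f.strictAnti_flow_time t x).lt_iff_gt (a := s) (b := f.hit a t x) |>.symm

theorem le_hit_iff {a s t x : ℝ} : s ≤ f.hit a t x ↔ a ≤ f.flow s t x := by
  rw [← not_lt, ← not_lt, hit_lt_iff]

theorem hit_le_iff {a s t x : ℝ} : f.hit a t x ≤ s ↔ f.flow s t x ≤ a := by
  rw [← not_lt, ← not_lt, lt_hit_iff]

theorem strictMono_hit (a t : ℝ) : StrictMono (f.hit a t) := fun x x' h => by
  simpa [lt_hit_iff] using f.strictMono_flow (f.hit a t x) t h

theorem continuous_hit : Continuous fun q : ℝ × ℝ × ℝ => f.hit q.1 q.2.1 q.2.2 := by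
  refine continuous_iff_continuousAt.2 fun ⟨a, t, x⟩ => tendsto_iff_dist_tendsto_zero.2 ?_
  have hle : ∀ q : ℝ × ℝ × ℝ, dist (f.hit q.1 q.2.1 q.2.2) (f.hit a t x) ≤
      dist q.1 (f.flow (f.hit a t x) q.2.1 q.2.2) / f.gap := by
    rintro ⟨a', t', x'⟩
    rw [le_div_iff₀' (NNReal.coe_pos.2 f.gap_pos)]
    simpa only [flow_hit] using f.gap_mul_dist_le (f.hit a' t' x') (f.hit a t x) t' x'
  have hflow : Continuous fun q : ℝ × ℝ × ℝ => f.flow (f.hit a t x) q.2.1 q.2.2 :=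
    f.continuous_flow.comp (continuous_const.prodMk continuous_snd)
  have hcont : Continuous fun q : ℝ × ℝ × ℝ =>
      dist q.1 (f.flow (f.hit a t x) q.2.1 q.2.2) / f.gap := by fun_prop
  exact squeeze_zero (fun _ => dist_nonneg) hle (by simpa using hcont.tendsto (a, t, x))

theorem gap_mul_abs_hit_sub_le (a t x : ℝ) : f.gap * |f.hit a t x - t| ≤ |a - x| := by
  simpa [Real.dist_eq] using f.gap_mul_dist_le (f.hit a t x) t t x

/-- The bound `exp (lip / gap)` for the distortion of lengths by the flow along a characteristic
that travels at most a unit distance. -/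
noncomputable def distortion : ℝ≥0 := (Real.exp (f.lip / f.gap)).toNNReal

theorem exp_lip_mul_le {a t x : ℝ} (hx : |a - x| ≤ 1) :
    Real.exp (f.lip * |f.hit a t x - t|) ≤ f.distortion := by
  have hgap := NNReal.coe_pos.2 f.gap_pos
  rw [distortion, Real.coe_toNNReal _ (Real.exp_pos _).le, div_eq_mul_one_div]
  gcongr
  rw [le_div_iff₀' hgap]
  exact (f.gap_mul_abs_hit_sub_le a t x).trans hx

theorem dist_hit_le {a t x : ℝ} (hx : |a - x| ≤ 1) (x' : ℝ) :
    dist (f.hit a t x) (f.hit a t x') ≤ ↑(f.distortion / f.gap) * dist x x' := by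
  have htime := f.gap_mul_dist_le (f.hit a t x') (f.hit a t x) t x'
  rw [NNReal.coe_div, div_mul_eq_mul_div, le_div_iff₀' (NNReal.coe_pos.2 f.gap_pos),
    mul_comm (f.distortion : ℝ), dist_comm (f.hit a t x)]
  calc (f.gap : ℝ) * dist (f.hit a t x') (f.hit a t x)
      ≤ dist (f.flow (f.hit a t x) t x) (f.flow (f.hit a t x) t x') := by
        simpa only [flow_hit] using htime
    _ ≤ dist x x' * Real.exp (f.lip * |f.hit a t x - t|) := f.dist_flow_le _ _ _ _
    _ ≤ dist x x' * f.distortion := by gcongr; exact f.exp_lip_mul_le hx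

theorem dist_le_dist_hit {a t x : ℝ} (hx : |a - x| ≤ 1) (x' : ℝ) :
    dist x x' ≤ ↑(f.bound * f.distortion) * dist (f.hit a t x) (f.hit a t x') := by
  have hspace := (f.lipschitzWith_flow_time t x').dist_le_mul (f.hit a t x') (f.hit a t x)
  rw [NNReal.coe_mul, mul_right_comm, dist_comm (f.hit a t x)]
  calc dist x x' ≤ dist (f.flow (f.hit a t x) t x) (f.flow (f.hit a t x) t x') *
        Real.exp (f.lip * |f.hit a t x - t|) := f.dist_le_dist_flow _ _ _ _
    _ ≤ f.bound * dist (f.hit a t x') (f.hit a t x) * f.distortion := by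
        gcongr
        · simpa only [flow_hit] using hspace
        · exact f.exp_lip_mul_le hx

theorem lipschitzOnWith_hit (t : ℝ) :
    LipschitzOnWith (f.distortion / f.gap) (f.hit 0 t) (Icc 0 1) :=
  .of_dist_le_mul fun x hx x' _ =>
    f.dist_hit_le (by simpa [abs_of_nonneg hx.1] using hx.2) x'

theorem antilipschitzWith_restrict_hit (t : ℝ) :
    AntilipschitzWith (f.bound * f.distortion) ((Icc 0 1).domRestrict (f.hit 0 t)) :=
  .of_le_mul_dist fun x x' =>
    f.dist_le_dist_hit (by simpa [abs_of_nonneg x.2.1] using x.2.2) _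

theorem antilipschitzWith_hit_time {a b : ℝ} (hab : |b - a| ≤ 1) :
    AntilipschitzWith (f.bound * (f.distortion / f.gap)) fun t => f.hit a t b := by
  refine .of_le_mul_dist fun t t' => ?_
  have hflow : dist (f.flow (f.hit a t b) (f.hit a t' b) a) a ≤
      f.bound * dist (f.hit a t b) (f.hit a t' b) := by
    simpa using (f.lipschitzWith_flow_time (f.hit a t' b) a).dist_le_mul
      (f.hit a t b) (f.hit a t' b)
  have hhit := f.dist_hit_le (t := f.hit a t b) hab (f.flow (f.hit a t b) (f.hit a t' b) a)
  rw [hit_hit, hit_flow, hit_hit, hit_self, hit_self, dist_comm a] at hhit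
  calc dist t t' ≤ _ := hhit
    _ ≤ ↑(f.distortion / f.gap) * (f.bound * dist (f.hit a t b) (f.hit a t' b)) := by gcongr
    _ = _ := by push_cast; ring

end NegativeField

section Measure

theorem ae_restrict_of_locally {X : Type*} [TopologicalSpace X] [SecondCountableTopology X]
    [MeasurableSpace X] {μ : Measure X} {s : Set X} (hs : MeasurableSet s) {P : X → Prop}
    (h : ∀ x ∈ s, ∃ u ∈ 𝓝[s] x, ∀ᵐ y ∂μ.restrict u, P y) : ∀ᵐ y ∂μ.restrict s, P y := by
  rw [ae_iff, Measure.restrict_apply' hs]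
  refine measure_null_of_locally_null _ fun x hx => ?_
  obtain ⟨u, hu, hP⟩ := h x hx.2
  refine ⟨{y | ¬P y} ∩ u, ?_, measure_mono_null le_rfl
    (nonpos_iff_eq_zero.1 ((Measure.le_restrict_apply u _).trans (ae_iff.1 hP).le))⟩
  rw [nhdsWithin_inter]
  exact inter_mem_inf self_mem_nhdsWithin hu

theorem frequently_nhdsGT_of_ae {a b : ℝ} (hab : a < b) {P : ℝ → Prop}
    (h : ∀ᵐ x ∂volume.restrict (Ioo a b), P x) : ∃ᶠ x in 𝓝[>] a, P x := by
  intro hn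
  obtain ⟨c, hac, hc⟩ := (mem_nhdsGT_iff_exists_mem_Ioc_Ioo_subset hab).1 hn
  have hfalse : ∀ᵐ _ ∂volume.restrict (Ioo a c), False := by
    filter_upwards [ae_restrict_mem measurableSet_Ioo,
      ae_restrict_of_ae_restrict_of_subset (Ioo_subset_Ioo_right hac.2) h] with _ hx hP
    exact hc hx hP
  rw [eventually_false_iff_eq_bot, ae_eq_bot, Measure.restrict_eq_zero] at hfalse
  simp [hac.1.not_ge] at hfalse

theorem map_restrict_le_of_antilipschitz {φ : ℝ → ℝ} (hφ : Measurable φ) {I J : Set ℝ}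
    (hI : MeasurableSet I) (hIJ : MapsTo φ I J) {C : ℝ≥0}
    (h : AntilipschitzWith C (I.domRestrict φ)) :
    (volume.restrict I).map φ ≤ (C : ℝ≥0∞) • volume.restrict J := by
  refine Measure.le_iff.2 fun A hA => ?_
  have himage : φ ⁻¹' A ∩ I = Subtype.val '' (I.domRestrict φ ⁻¹' (A ∩ J)) := by
    ext x
    simp only [mem_inter_iff, mem_preimage, mem_image, Set.domRestrict_apply, Subtype.exists,
      exists_and_left, exists_prop, exists_eq_right_right]
    exact ⟨fun hx => ⟨⟨hx.1, hIJ hx.2⟩, hx.2⟩, fun hx => ⟨hx.1.1, hx.2⟩⟩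
  rw [Measure.map_apply hφ hA, Measure.restrict_apply' hI, himage, ← hausdorffMeasure_real,
    isometry_subtype_coe.hausdorffMeasure_image (Or.inl zero_le_one), Measure.smul_apply,
    Measure.restrict_apply hA]
  simpa using h.hausdorffMeasure_preimage_le zero_le_one (A ∩ J)

theorem ae_comp_of_antilipschitz {φ : ℝ → ℝ} (hφ : Measurable φ) {I J : Set ℝ}
    (hI : MeasurableSet I) (hIJ : MapsTo φ I J) {C : ℝ≥0}
    (h : AntilipschitzWith C (I.domRestrict φ)) {P : ℝ → Prop}
    (hP : ∀ᵐ y ∂volume.restrict J, P y) : ∀ᵐ x ∂volume.restrict I, P (φ x) :=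
  ae_of_ae_map hφ.aemeasurable ((Measure.absolutelyContinuous_of_le
    (map_restrict_le_of_antilipschitz hφ hI hIJ h)).trans
      Measure.smul_absolutelyContinuous |>.ae_le hP)

theorem volume_image_eq_zero_of_lipschitzOnWith {θ : ℝ → ℝ} {K : ℝ≥0} {s : Set ℝ}
    (h : LipschitzOnWith K θ s) (hs : volume s = 0) : volume (θ '' s) = 0 := by
  rw [← hausdorffMeasure_real] at hs ⊢
  refine nonpos_iff_eq_zero.1 ((h.hausdorffMeasure_image_le zero_le_one).trans_eq ?_)
  rw [hs, mul_zero]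

theorem image_Ioo_ae_eq_of_lipschitzOnWith {θ : ℝ → ℝ} {a b : ℝ} (hab : a ≤ b)
    (hmono : StrictMonoOn θ (Icc a b)) {K : ℝ≥0} (hθ : LipschitzOnWith K θ (Icc a b)) {D : Set ℝ}
    (hD : D ⊆ Ioo a b) (hDae : volume (Ioo a b \ D) = 0) : θ '' D =ᵐ[volume] Ioo (θ a) (θ b) := by
  refine EventuallyLE.antisymm (LE.le.eventuallyLE ?_) (ae_le_set.2 (measure_mono_null ?_
    (volume_image_eq_zero_of_lipschitzOnWith
      (hθ.mono (sdiff_subset.trans Ioo_subset_Icc_self)) hDae)))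
  · rintro _ ⟨η, hη, rfl⟩
    have hη' := hD hη
    exact ⟨hmono (left_mem_Icc.2 hab) (Ioo_subset_Icc_self hη') hη'.1,
      hmono (Ioo_subset_Icc_self hη') (right_mem_Icc.2 hab) hη'.2⟩
  · rintro x ⟨hx, hx'⟩
    obtain ⟨η, hη, rfl⟩ := intermediate_value_Ioo hab hθ.continuousOn hx
    exact mem_image_of_mem θ ⟨hη, fun hηD => hx' (mem_image_of_mem θ hηD)⟩

theorem integral_eq_integral_deriv_smul_of_lipschitzOnWith {E : Type*} [NormedAddCommGroup E]
    [NormedSpace ℝ E] {θ : ℝ → ℝ} {a b : ℝ} (hab : a ≤ b) (hmono : StrictMonoOn θ (Icc a b))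
    {K : ℝ≥0} (hθ : LipschitzOnWith K θ (Icc a b)) (g : ℝ → E) :
    ∫ x in θ a..θ b, g x = ∫ η in a..b, deriv θ η • g (θ η) := by
  set D := Ioo a b ∩ {η | DifferentiableAt ℝ θ η}
  have hDae : D =ᵐ[volume] Ioo a b := by
    filter_upwards [hθ.ae_differentiableWithinAt_of_mem_real] with η hη
    exact propext ⟨And.left, fun h => ⟨h, (hη (Ioo_subset_Icc_self h)).differentiableAt
      (Icc_mem_nhds h.1 h.2)⟩⟩
  rw [intervalIntegral.integral_of_le
      (hmono.monotoneOn (left_mem_Icc.2 hab) (right_mem_Icc.2 hab) hab),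
    intervalIntegral.integral_of_le hab, integral_Ioc_eq_integral_Ioo,
    integral_Ioc_eq_integral_Ioo, ← setIntegral_congr_set hDae,
    ← setIntegral_congr_set (image_Ioo_ae_eq_of_lipschitzOnWith hab hmono hθ inter_subset_left
      (ae_le_set.1 hDae.symm.le))]
  exact integral_image_eq_integral_deriv_smul_of_monotoneOn
    (measurableSet_Ioo.inter (measurableSet_of_differentiableAt ℝ θ))
    (fun η hη => hη.2.hasDerivAt.hasDerivWithinAt)
    (hmono.monotoneOn.mono (inter_subset_left.trans Ioo_subset_Icc_self)) g

theorem ae_ae_of_ae_restrict_prod {A B : Set ℝ} {P : ℝ × ℝ → Prop}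
    (h : ∀ᵐ q ∂(volume.restrict (A ×ˢ B) : Measure (ℝ × ℝ)), P q) :
    ∀ᵐ t ∂volume.restrict A, ∀ᵐ x ∂volume.restrict B, P (t, x) := by
  rw [Measure.volume_eq_prod, ← Measure.prod_restrict] at h
  exact Measure.ae_ae_of_ae_prod h

theorem ae_ae_of_ae_restrict_prod_swap {A B : Set ℝ} {P : ℝ × ℝ → Prop}
    (h : ∀ᵐ q ∂(volume.restrict (A ×ˢ B) : Measure (ℝ × ℝ)), P q) :
    ∀ᵐ x ∂volume.restrict B, ∀ᵐ t ∂volume.restrict A, P (t, x) := by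
  refine ae_ae_of_ae_restrict_prod (P := P ∘ Prod.swap) ?_
  rw [Measure.volume_eq_prod, ← Measure.prod_restrict] at h ⊢
  exact Measure.measurePreserving_swap.quasiMeasurePreserving.ae h

variable {ι α E : Type*} [NormedAddCommGroup E] {l : Filter ι} [l.IsCountablyGenerated]
  [MeasurableSpace α] {μ ν : Measure α} {p : ℝ≥0∞}

theorem tendsto_eLpNorm_zero_of_bounded [IsFiniteMeasure μ] (hp : p ≠ ∞) (hp0 : p ≠ 0)
    {F : ι → α → E} (hF : ∀ᶠ i in l, AEStronglyMeasurable (F i) μ) {C : ℝ}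
    (hb : ∀ᶠ i in l, ∀ᵐ x ∂μ, ‖F i x‖ ≤ C)
    (hlim : ∀ᵐ x ∂μ, Tendsto (fun i => F i x) l (𝓝 0)) :
    Tendsto (fun i => eLpNorm (F i) p μ) l (𝓝 0) := by
  have hpos := ENNReal.toReal_pos hp0 hp
  have hint : Tendsto (fun i => ∫⁻ x, ‖F i x‖ₑ ^ p.toReal ∂μ) l (𝓝 (∫⁻ _, 0 ∂μ)) := by
    refine tendsto_lintegral_filter_of_dominated_convergence'
      (fun _ => ENNReal.ofReal C ^ p.toReal) (hF.mono fun i hi => hi.enorm.pow_const _)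
      (hb.mono fun i hi => hi.mono fun x hx => ?_) ?_ (hlim.mono fun x hx => ?_)
    · gcongr
      rw [← ofReal_norm]
      exact ENNReal.ofReal_le_ofReal hx
    · rw [lintegral_const]
      finiteness
    · simpa [hpos] using hx.enorm.ennrpow_const p.toReal
  simp_rw [eLpNorm_eq_lintegral_rpow_enorm_toReal hp0 hp]
  simpa [hpos] using hint.ennrpow_const (1 / p.toReal)

theorem aestronglyMeasurable_comp_of_map_le {C : ℝ≥0∞} {φ : α → α} (hφ : AEMeasurable φ μ)
    (hmap : μ.map φ ≤ C • ν) {u : α → E} (hu : AEStronglyMeasurable u ν) :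
    AEStronglyMeasurable (u ∘ φ) μ :=
  ((hu.smul_measure C).mono_measure hmap).comp_aemeasurable hφ

theorem eLpNorm_comp_le_of_map_le (hp : p ≠ ∞) {C : ℝ≥0∞} {φ : α → α} (hφ : AEMeasurable φ μ)
    (hmap : μ.map φ ≤ C • ν) {u : α → E} (hu : AEStronglyMeasurable u ν) :
    eLpNorm (u ∘ φ) p μ ≤ C ^ (1 / p).toReal * eLpNorm u p ν := by
  rw [← eLpNorm_map_measure ((hu.smul_measure C).mono_measure hmap) hφ, ← smul_eq_mul,
    ← eLpNorm_smul_measure_of_ne_top hp]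
  exact eLpNorm_mono_measure u hmap

theorem eLpNorm_comp_sub_le (hp1 : 1 ≤ p) (hp : p ≠ ∞) (hμν : μ ≤ ν) {C : ℝ≥0∞} {φ : α → α}
    (hφ : AEMeasurable φ μ) (hmap : μ.map φ ≤ C • ν) {u f g : α → E}
    (hu : AEStronglyMeasurable u ν) (hf : AEStronglyMeasurable f ν)
    (hg : AEStronglyMeasurable g ν) :
    eLpNorm (u ∘ φ - f) p μ ≤ C ^ (1 / p).toReal * eLpNorm (u - f) p ν +
      eLpNorm (g ∘ φ - g) p μ + (C ^ (1 / p).toReal + 1) * eLpNorm (f - g) p ν := by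
  have hcomp {v : α → E} (hv : AEStronglyMeasurable v ν) : AEStronglyMeasurable (v ∘ φ) μ :=
    aestronglyMeasurable_comp_of_map_le hφ hmap hv
  have huf := hcomp (hu.sub hf)
  have hgg := (hcomp hg).sub (hg.mono_measure hμν)
  have hfg := hcomp (hf.sub hg)
  have hgf : AEStronglyMeasurable (g - f) μ := (hg.sub hf).mono_measure hμν
  calc eLpNorm (u ∘ φ - f) p μ
      = eLpNorm (((u - f) ∘ φ + (g ∘ φ - g)) + ((f - g) ∘ φ + (g - f))) p μ := by
        congr 1; ext x; simp only [Pi.add_apply, Pi.sub_apply, Function.comp_apply]; abel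
    _ ≤ (eLpNorm ((u - f) ∘ φ) p μ + eLpNorm (g ∘ φ - g) p μ) +
          (eLpNorm ((f - g) ∘ φ) p μ + eLpNorm (g - f) p μ) :=
        (eLpNorm_add_le (huf.add hgg) (hfg.add hgf) hp1).trans
          (add_le_add (eLpNorm_add_le huf hgg hp1) (eLpNorm_add_le hfg hgf hp1))
    _ ≤ _ := by
        rw [eLpNorm_sub_comm g f, add_one_mul]
        gcongr
        exacts [eLpNorm_comp_le_of_map_le hp hφ hmap (hu.sub hf),
          eLpNorm_comp_le_of_map_le hp hφ hmap (hf.sub hg)]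

variable [TopologicalSpace α] [NormalSpace α] [BorelSpace α] [NormedSpace ℝ E]
  [IsFiniteMeasure μ] [ν.WeaklyRegular] {C : ℝ≥0∞} {φ : ι → α → α} {F : ι → α → E} {f : α → E}

theorem tendsto_eLpNorm_comp_sub (hp1 : 1 ≤ p) (hp : p ≠ ∞) (hC : C ≠ ∞) (hμν : μ ≤ ν)
    (hφ : ∀ i, Measurable (φ i)) (hmap : ∀ᶠ i in l, μ.map (φ i) ≤ C • ν)
    (hid : ∀ᵐ x ∂μ, Tendsto (fun i => φ i x) l (𝓝 x))
    (hF : ∀ᶠ i in l, AEStronglyMeasurable (F i) ν) (hf : MemLp f p ν)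
    (hFf : Tendsto (fun i => eLpNorm (F i - f) p ν) l (𝓝 0)) :
    Tendsto (fun i => eLpNorm (F i ∘ φ i - f) p μ) l (𝓝 0) := by
  set K := C ^ (1 / p).toReal
  have hK : K ≠ ∞ := ENNReal.rpow_ne_top_of_nonneg ENNReal.toReal_nonneg hC
  refine ENNReal.tendsto_nhds_zero.2 fun ε hε => ?_
  have hε2 : 0 < ε / 2 := ENNReal.half_pos hε.ne'
  obtain ⟨g, hfg, hg⟩ := hf.exists_boundedContinuous_eLpNorm_sub_le hp
    (ε := ε / 2 / (K + 1)) (ENNReal.div_pos hε2.ne' (by finiteness)).ne'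
  have hcont : Tendsto (fun i => eLpNorm (⇑g ∘ φ i - ⇑g) p μ) l (𝓝 0) := by
    refine tendsto_eLpNorm_zero_of_bounded hp (zero_lt_one.trans_le hp1).ne'
      (hmap.mono fun i hi => (aestronglyMeasurable_comp_of_map_le (hφ i).aemeasurable hi hg.1).sub
        (hg.1.mono_measure hμν)) (C := 2 * ‖g‖)
      (.of_forall fun i => .of_forall fun x => ?_) (hid.mono fun x hx => ?_)
    · simpa [dist_eq_norm] using g.dist_le_two_norm (φ i x) x
    · simpa using ((g.continuous.tendsto x).comp hx).sub_const (g x)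
  have hsmall := (ENNReal.Tendsto.const_mul hFf (Or.inr hK)).add hcont
  rw [mul_zero, add_zero] at hsmall
  filter_upwards [ENNReal.tendsto_nhds_zero.1 hsmall (ε / 2) hε2, hmap, hF] with i hi hmapi hFi
  calc eLpNorm (F i ∘ φ i - f) p μ
      ≤ K * eLpNorm (F i - f) p ν + eLpNorm (⇑g ∘ φ i - ⇑g) p μ +
          (K + 1) * eLpNorm (f - ⇑g) p ν :=
        eLpNorm_comp_sub_le hp1 hp hμν (hφ i).aemeasurable hmapi hFi hf.1 hg.1
    _ ≤ ε / 2 + (K + 1) * (ε / 2 / (K + 1)) := by gcongr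
    _ ≤ ε := by
        grw [ENNReal.mul_div_le, ENNReal.add_halves]

theorem ae_eq_of_comp_ae_eq (hp1 : 1 ≤ p) (hp : p ≠ ∞) (hC : C ≠ ∞) (hμν : μ ≤ ν)
    (hφ : ∀ i, Measurable (φ i)) (hmap : ∀ᶠ i in l, μ.map (φ i) ≤ C • ν)
    (hid : ∀ᵐ x ∂μ, Tendsto (fun i => φ i x) l (𝓝 x))
    (hF : ∀ᶠ i in l, AEStronglyMeasurable (F i) ν) (hf : MemLp f p ν)
    (hFf : Tendsto (fun i => eLpNorm (F i - f) p ν) l (𝓝 0)) {h : α → E}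
    (hcomp : ∃ᶠ i in l, F i ∘ φ i =ᵐ[μ] h) : f =ᵐ[μ] h := by
  have hlim := tendsto_eLpNorm_comp_sub hp1 hp hC hμν hφ hmap hid hF hf hFf
  have hzero : eLpNorm (h - f) p μ ≤ 0 := ge_of_tendsto_of_frequently hlim <|
    hcomp.mono fun i hi => (eLpNorm_congr_ae (hi.sub (ae_eq_refl f))).ge
  obtain ⟨i, hi, hmapi, hFi⟩ := (hcomp.and_eventually (hmap.and hF)).exists
  have hh : AEStronglyMeasurable h μ :=
    (aestronglyMeasurable_comp_of_map_le (hφ i).aemeasurable hmapi hFi).congr hi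
  have hsub := (eLpNorm_eq_zero_iff (hh.sub (hf.1.mono_measure hμν))
    (zero_lt_one.trans_le hp1).ne').1 (nonpos_iff_eq_zero.1 hzero)
  filter_upwards [hsub] with x hx using (sub_eq_zero.1 hx).symm

end Measure

namespace NegativeField

variable (f : NegativeField) {E : Type*} [NormedAddCommGroup E] [NormedSpace ℝ E] {t0 : ℝ}
  {z : ℝ → ℝ → E} {β : ℝ → E}

theorem eventually_mapsTo_hit {a : ℝ} (ha : t0 < a) (b : ℝ) :
    ∀ᶠ x in 𝓝[>] 0, x ∈ Icc (0 : ℝ) 1 ∧ MapsTo (fun τ => f.hit x τ 0) (Ioo a b) (Ioo t0 b) := by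
  have hgap : 0 < f.gap * (a - t0) := mul_pos f.gap_pos (sub_pos.2 ha)
  filter_upwards [Ioo_mem_nhdsGT (lt_min zero_lt_one hgap)] with x hx
  refine ⟨⟨hx.1.le, hx.2.le.trans (min_le_left _ _)⟩, fun τ hτ => ⟨f.lt_hit_iff.2 ?_, ?_⟩⟩
  · have hflow := f.flow_sub_flow_le (ha.trans hτ.1).le τ 0
    rw [f.flow_self] at hflow
    nlinarith [hx.2.trans_le (min_le_right _ _), hτ.1, NNReal.coe_pos.2 f.gap_pos]
  · exact (f.hit_le_iff.2 (by rw [f.flow_self]; exact hx.1.le)).trans_lt hτ.2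

theorem ae_eq_trace
    (hz : ∀ᵐ q ∂volume.restrict (Ioi t0 ×ˢ Ioo (0 : ℝ) 1), z q.1 q.2 = β (f.hit 0 q.1 q.2))
    (hmem : ∀ T > 0, ∀ x ∈ Icc (0 : ℝ) 1,
      MemLp (fun t => z t x) 2 (volume.restrict (Ioo t0 (t0 + T))))
    (hcont : ∀ T > 0, Tendsto (fun x => eLpNorm (fun t => z t x - z t 0) 2
      (volume.restrict (Ioo t0 (t0 + T)))) (𝓝[Icc 0 1] 0) (𝓝 0)) :
    ∀ᵐ τ ∂volume.restrict (Ioi t0), z τ 0 = β τ := by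
  refine ae_restrict_of_locally measurableSet_Ioi fun τ₀ hτ₀ => ?_
  obtain ⟨a, hta, haτ⟩ := exists_between (mem_Ioi.1 hτ₀)
  obtain ⟨T, hT, hτT⟩ : ∃ T > 0, τ₀ < t0 + T := ⟨τ₀ - t0 + 1, by linarith, by linarith⟩
  have hmaps := f.eventually_mapsTo_hit hta (t0 + T)
  have hmeas (x : ℝ) : Measurable fun τ => f.hit x τ 0 :=
    (f.continuous_hit.comp (by fun_prop : Continuous fun τ : ℝ => (x, τ, (0 : ℝ)))).measurable
  have hanti {x : ℝ} (hx : x ∈ Icc (0 : ℝ) 1) := (f.antilipschitzWith_hit_time (a := x) (b := 0)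
    (by rw [zero_sub, abs_neg, abs_of_nonneg hx.1]; exact hx.2)).domRestrict (Ioo a (t0 + T))
  refine ⟨Ioo a (t0 + T), mem_nhdsWithin_of_mem_nhds (Ioo_mem_nhds haτ hτT),
    ae_eq_of_comp_ae_eq (l := 𝓝[>] 0) (φ := fun x τ => f.hit x τ 0) (F := fun x τ => z τ x)
    (p := 2) one_le_two (by simp) ENNReal.coe_ne_top
    (Measure.restrict_mono_set volume (Ioo_subset_Ioo_left hta.le)) hmeas
    (hmaps.mono fun x hx => map_restrict_le_of_antilipschitz (hmeas x) measurableSet_Ioo hx.2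
      (hanti hx.1)) (.of_forall fun τ => ?_)
    (hmaps.mono fun x hx => (hmem T hT x hx.1).aestronglyMeasurable)
    (hmem T hT 0 (left_mem_Icc.2 zero_le_one))
    ((hcont T hT).mono_left (nhdsWithin_le_of_mem (Icc_mem_nhdsGT zero_lt_one))) ?_⟩
  · have hlim := ((f.continuous_hit.comp
      (by fun_prop : Continuous fun x : ℝ => (x, τ, (0 : ℝ)))).tendsto 0).mono_left
        (nhdsWithin_le_nhds (s := Ioi 0))
    rwa [Function.comp_apply, f.hit_self] at hlim
  · refine ((frequently_nhdsGT_of_ae zero_lt_one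
      (ae_ae_of_ae_restrict_prod_swap hz)).and_eventually hmaps).mono fun x hx => ?_
    filter_upwards [ae_comp_of_antilipschitz (hmeas x) measurableSet_Ioo hx.2.2 (hanti hx.2.1)
      (ae_restrict_of_ae_restrict_of_subset Ioo_subset_Ioi_self hx.1)] with τ hτ
    simpa [f.hit_hit] using hτ

theorem eventually_mapsTo_flow (s : ℝ) {a a' b b' : ℝ} (ha : a' < a) (hb : b < b') :
    ∀ᶠ r in 𝓝 s, MapsTo (f.flow r s) (Ioo a b) (Ioo a' b') := by
  have hcont (x : ℝ) : Tendsto (fun r => f.flow r s x) (𝓝 s) (𝓝 x) := by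
    simpa using (f.lipschitzWith_flow_time s x).continuous.tendsto s
  filter_upwards [(hcont a).eventually_const_lt ha, (hcont b).eventually_lt_const hb]
    with r hra hrb x hx
  exact ⟨hra.trans (f.strictMono_flow r s hx.1), (f.strictMono_flow r s hx.2).trans hrb⟩

theorem ae_eq_section
    (hz : ∀ᵐ q ∂volume.restrict (Ioi t0 ×ˢ Ioo (0 : ℝ) 1), z q.1 q.2 = β (f.hit 0 q.1 q.2))
    (hmem : ∀ s, t0 ≤ s → MemLp (z s) 2 (volume.restrict (Ioo (0 : ℝ) 1))) {s : ℝ} (hs : t0 ≤ s)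
    (hcont : Tendsto (fun r => eLpNorm (fun x => z r x - z s x) 2
      (volume.restrict (Ioo (0 : ℝ) 1))) (𝓝[Ici t0] s) (𝓝 0)) :
    ∀ᵐ ξ ∂volume.restrict (Ioo (0 : ℝ) 1), z s ξ = β (f.hit 0 s ξ) := by
  refine ae_restrict_of_locally measurableSet_Ioo fun ξ₀ hξ₀ => ?_
  obtain ⟨a, ha, haξ⟩ := exists_between hξ₀.1
  obtain ⟨b, hξb, hb⟩ := exists_between hξ₀.2
  have hmaps : ∀ᶠ r in 𝓝[>] s, t0 ≤ r ∧ |r - s| ≤ 1 ∧ MapsTo (f.flow r s) (Ioo a b) (Ioo 0 1) := by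
    filter_upwards [nhdsWithin_le_nhds (f.eventually_mapsTo_flow s ha hb),
      Ioo_mem_nhdsGT (lt_add_one s)] with r hr hrs
    exact ⟨hs.trans hrs.1.le, abs_le.2 ⟨by linarith [hrs.1], by linarith [hrs.2]⟩, hr⟩
  have hmeas (r : ℝ) : Measurable (f.flow r s) :=
    (f.continuous_flow.comp (by fun_prop : Continuous fun x : ℝ => (r, s, x))).measurable
  have hanti {r : ℝ} (hr : |r - s| ≤ 1) :
      AntilipschitzWith (Real.exp f.lip).toNNReal (f.flow r s) := by
    refine AntilipschitzWith.of_le_mul_dist fun x x' => (f.dist_le_dist_flow r s x x').trans ?_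
    rw [mul_comm, Real.coe_toNNReal _ (Real.exp_nonneg _)]
    gcongr
    exact mul_le_of_le_one_right f.lip.coe_nonneg hr
  refine ⟨Ioo a b, mem_nhdsWithin_of_mem_nhds (Ioo_mem_nhds haξ hξb),
    ae_eq_of_comp_ae_eq (l := 𝓝[>] s) (φ := fun r => f.flow r s) (F := z)
    (p := 2) one_le_two (by simp) ENNReal.coe_ne_top
    (Measure.restrict_mono_set volume (Ioo_subset_Ioo ha.le hb.le)) hmeas
    (hmaps.mono fun r hr => map_restrict_le_of_antilipschitz (hmeas r) measurableSet_Ioo hr.2.2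
      ((hanti hr.2.1).domRestrict _)) (.of_forall fun ξ => ?_)
    (hmaps.mono fun r hr => (hmem r hr.1).aestronglyMeasurable) (hmem s hs)
    (hcont.mono_left (nhdsWithin_mono s (Ioi_subset_Ici hs))) ?_⟩
  · have hlim := ((f.lipschitzWith_flow_time s ξ).continuous.tendsto s).mono_left
      (nhdsWithin_le_nhds (s := Ioi s))
    rwa [f.flow_self] at hlim
  · refine ((frequently_nhdsGT_of_ae (lt_add_one s) (ae_restrict_of_ae_restrict_of_subset
      (Ioo_subset_Ioi_self.trans (Ioi_subset_Ioi hs))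
      (ae_ae_of_ae_restrict_prod hz))).and_eventually hmaps).mono fun r hr => ?_
    filter_upwards [ae_comp_of_antilipschitz (hmeas r) measurableSet_Ioo hr.2.2.2
      ((hanti hr.2.2.1).domRestrict _) hr.1] with ξ hξ
    simpa [f.hit_flow] using hξ

end NegativeField

/-! ### Resolvents of strictly triangular kernels -/

section Resolvent

variable {X : Type*} [MeasurableSpace X] {μ : Measure X} {m : ℕ}

/-- The resolvent `R = κ + κ ∘ κ + κ ∘ κ ∘ κ + ⋯` of a strictly lower triangular matrix `κ` of
integral kernels, for the composition `(κ ∘ R)(ξ, ζ) = ∫ κ(ξ, η) R(η, ζ) dμ(η)`. Row `i` is computed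
from the rows above it by `R = κ + κ ∘ R`. -/
noncomputable def resolventKernel (μ : Measure X) (κ : Fin m → Fin m → X → X → ℝ) (i j : Fin m)
    (ξ ζ : X) : ℝ :=
  κ i j ξ ζ + ∑ l, if _ : l < i then ∫ η, κ i l ξ η * resolventKernel μ κ l j η ζ ∂μ else 0
termination_by i

/-- A strictly lower triangular matrix of measurable integral kernels bounded by `C`. -/
structure IsTriangularKernel (κ : Fin m → Fin m → X → X → ℝ) (C : ℝ≥0) : Prop where
  measurable : ∀ i j, Measurable (Function.uncurry (κ i j))
  norm_le : ∀ i j ξ η, ‖κ i j ξ η‖ ≤ C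
  eq_zero : ∀ i j, i ≤ j → ∀ ξ η, κ i j ξ η = 0

namespace IsTriangularKernel

variable {κ : Fin m → Fin m → X → X → ℝ} {C : ℝ≥0} {u : Fin m → X → ℝ}

theorem resolventKernel_eq (hκ : IsTriangularKernel κ C) (i j : Fin m) (ξ ζ : X) :
    resolventKernel μ κ i j ξ ζ =
      κ i j ξ ζ + ∑ l, ∫ η, κ i l ξ η * resolventKernel μ κ l j η ζ ∂μ := by
  rw [resolventKernel]
  congr 1
  refine Finset.sum_congr rfl fun l _ => ?_
  split_ifs with hl
  · rfl
  · simp [hκ.eq_zero i l (not_lt.1 hl)]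

theorem integrable_mul (hκ : IsTriangularKernel κ C) (i j : Fin m) (ξ : X)
    (hu : Integrable (u j) μ) : Integrable (fun η => κ i j ξ η * u j η) μ :=
  hu.bdd_mul ((hκ.measurable i j).of_uncurry_left).aestronglyMeasurable
    (Eventually.of_forall (hκ.norm_le i j ξ))

end IsTriangularKernel

variable [IsFiniteMeasure μ]

theorem integrable_bounded_mul_comp_snd {Y : Type*} [MeasurableSpace Y] {ν : Measure Y}
    [IsFiniteMeasure ν] {k : Y × X → ℝ} {u : X → ℝ} {C : ℝ} (hk : Measurable k)
    (hC : ∀ q, ‖k q‖ ≤ C) (hu : Integrable u μ) :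
    Integrable (fun q : Y × X => k q * u q.2) (ν.prod μ) :=
  (hu.comp_snd ν).bdd_mul hk.aestronglyMeasurable (Eventually.of_forall hC)

theorem integral_mul_integral_mul_comm {k : X → ℝ} {R : X → X → ℝ} {u : X → ℝ} {C D : ℝ}
    (hk : Measurable k) (hkC : ∀ η, ‖k η‖ ≤ C) (hR : Measurable (Function.uncurry R))
    (hRD : ∀ η ζ, ‖R η ζ‖ ≤ D) (hu : Integrable u μ) :
    ∫ η, k η * ∫ ζ, R η ζ * u ζ ∂μ ∂μ = ∫ ζ, (∫ η, k η * R η ζ ∂μ) * u ζ ∂μ := by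
  have hint : Integrable (fun q : X × X => k q.1 * R q.1 q.2 * u q.2) (μ.prod μ) := by
    refine integrable_bounded_mul_comp_snd (k := fun q : X × X => k q.1 * R q.1 q.2) (C := C * D)
      ((hk.comp measurable_fst).mul hR) (fun q => ?_) hu
    rw [norm_mul]
    gcongr
    exacts [(norm_nonneg _).trans (hkC q.1), hkC _, hRD _ _]
  calc ∫ η, k η * ∫ ζ, R η ζ * u ζ ∂μ ∂μ = ∫ η, ∫ ζ, k η * R η ζ * u ζ ∂μ ∂μ := by
        simp only [mul_assoc, integral_const_mul]
    _ = ∫ ζ, ∫ η, k η * R η ζ * u ζ ∂μ ∂μ := integral_integral_swap hint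
    _ = ∫ ζ, (∫ η, k η * R η ζ ∂μ) * u ζ ∂μ := by simp only [integral_mul_const]

theorem norm_integral_mul_le {k r : X → ℝ} {C D : ℝ} (hC : ∀ η, ‖k η‖ ≤ C) (hD : ∀ η, ‖r η‖ ≤ D) :
    ‖∫ η, k η * r η ∂μ‖ ≤ C * D * μ.real univ := by
  refine norm_integral_le_of_norm_le_const (Eventually.of_forall fun η => ?_)
  rw [norm_mul]
  gcongr
  exacts [(norm_nonneg _).trans (hC η), hC η, hD η]

theorem measurable_resolventKernel {S : Type*} [MeasurableSpace S]
    {κ : S → Fin m → Fin m → X → X → ℝ}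
    (hκ : ∀ i j, Measurable fun q : S × X × X => κ q.1 i j q.2.1 q.2.2) (i j : Fin m) :
    Measurable fun q : S × X × X => resolventKernel μ (κ q.1) i j q.2.1 q.2.2 := by
  induction i using WellFoundedLT.induction with
  | ind i ih =>
    simp_rw +singlePass [resolventKernel]
    refine (hκ i j).add (Finset.measurable_sum _ fun l _ => ?_)
    split_ifs with hl
    · have hmul : Measurable fun q : (S × X × X) × X =>
          κ q.1.1 i l q.1.2.1 q.2 * resolventKernel μ (κ q.1.1) l j q.2 q.1.2.2 :=
        ((hκ i l).comp (f := fun q : (S × X × X) × X => (q.1.1, q.1.2.1, q.2)) (by fun_prop)).mul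
          ((ih l hl).comp (f := fun q : (S × X × X) × X => (q.1.1, q.2, q.1.2.2)) (by fun_prop))
      exact hmul.stronglyMeasurable.integral_prod_right'.measurable
    · exact measurable_const

theorem exists_norm_resolventKernel_le (μ : Measure X) [IsFiniteMeasure μ] (m : ℕ) (C : ℝ≥0) :
    ∃ D : ℝ≥0, ∀ κ : Fin m → Fin m → X → X → ℝ, (∀ i j ξ η, ‖κ i j ξ η‖ ≤ C) →
      ∀ i j ξ ζ, ‖resolventKernel μ κ i j ξ ζ‖ ≤ D := by
  suffices hrow : ∀ i : Fin m, ∃ D : ℝ≥0, ∀ κ : Fin m → Fin m → X → X → ℝ,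
      (∀ i j ξ η, ‖κ i j ξ η‖ ≤ C) → ∀ j ξ ζ, ‖resolventKernel μ κ i j ξ ζ‖ ≤ D by
    choose D hD using hrow
    exact ⟨∑ i, D i, fun κ hκ i j ξ ζ => (hD i κ hκ j ξ ζ).trans
      (NNReal.coe_le_coe.2 (Finset.single_le_sum (fun _ _ => zero_le) (Finset.mem_univ i)))⟩
  intro i
  induction i using WellFoundedLT.induction with
  | ind i ih =>
    choose D hD using ih
    refine ⟨C + ∑ l, if hl : l < i then C * D l hl * (μ univ).toNNReal else 0,
      fun κ hκ j ξ ζ => ?_⟩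
    rw [resolventKernel]
    push_cast
    refine (norm_add_le _ _).trans (add_le_add (hκ _ _ _ _)
      ((norm_sum_le _ _).trans (Finset.sum_le_sum fun l _ => ?_)))
    split_ifs with hl
    · exact norm_integral_mul_le (hκ i l ξ) fun η => hD l hl κ hκ j η ζ
    · simp

namespace IsTriangularKernel

variable {κ : Fin m → Fin m → X → X → ℝ} {C : ℝ≥0} {u v : Fin m → X → ℝ}

theorem measurable_uncurry_resolventKernel (hκ : IsTriangularKernel κ C) (i j : Fin m) :
    Measurable (Function.uncurry (resolventKernel μ κ i j)) :=
  (measurable_resolventKernel (S := Unit) (κ := fun _ => κ)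
    (fun i j => (hκ.measurable i j).comp measurable_snd) i j).comp
    (measurable_prodMk_left (x := ()))

theorem integral_mul_integral_resolvent (hκ : IsTriangularKernel κ C) (i l j : Fin m) (ξ : X)
    (hu : Integrable (u j) μ) :
    ∫ η, κ i l ξ η * ∫ ζ, resolventKernel μ κ l j η ζ * u j ζ ∂μ ∂μ =
      ∫ ζ, (∫ η, κ i l ξ η * resolventKernel μ κ l j η ζ ∂μ) * u j ζ ∂μ := by
  obtain ⟨D, hD⟩ := exists_norm_resolventKernel_le μ m C
  exact integral_mul_integral_mul_comm (hκ.measurable i l).of_uncurry_left (hκ.norm_le i l ξ)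
    (hκ.measurable_uncurry_resolventKernel l j) (hD κ hκ.norm_le l j) hu

theorem integrable_mul_integral_resolvent (hκ : IsTriangularKernel κ C) (i l j : Fin m) (ξ : X)
    (hu : Integrable (u j) μ) :
    Integrable (fun η => κ i l ξ η * ∫ ζ, resolventKernel μ κ l j η ζ * u j ζ ∂μ) μ := by
  obtain ⟨D, hD⟩ := exists_norm_resolventKernel_le μ m C
  have hint : Integrable (fun η => ∫ ζ, resolventKernel μ κ l j η ζ * u j ζ ∂μ) μ :=
    (integrable_bounded_mul_comp_snd (hκ.measurable_uncurry_resolventKernel l j)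
      (fun q => hD κ hκ.norm_le l j q.1 q.2) hu).integral_prod_left
  exact hint.bdd_mul ((hκ.measurable i l).of_uncurry_left).aestronglyMeasurable
    (Eventually.of_forall (hκ.norm_le i l ξ))

theorem integrable_integral_mul_resolvent (hκ : IsTriangularKernel κ C) (i l j : Fin m) (ξ : X)
    (hu : Integrable (u j) μ) :
    Integrable (fun ζ => (∫ η, κ i l ξ η * resolventKernel μ κ l j η ζ ∂μ) * u j ζ) μ := by
  obtain ⟨D, hD⟩ := exists_norm_resolventKernel_le μ m C
  have hmeas : Measurable fun q : X × X => κ i l ξ q.2 * resolventKernel μ κ l j q.2 q.1 :=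
    ((hκ.measurable i l).of_uncurry_left.comp measurable_snd).mul
      ((hκ.measurable_uncurry_resolventKernel l j).comp measurable_swap)
  exact hu.bdd_mul hmeas.stronglyMeasurable.integral_prod_right'.measurable.aestronglyMeasurable
    (Eventually.of_forall fun ζ => norm_integral_mul_le (hκ.norm_le i l ξ)
      fun η => hD κ hκ.norm_le l j η ζ)

theorem sum_integral_mul_add_resolvent (hκ : IsTriangularKernel κ C)
    (hu : ∀ j, Integrable (u j) μ) (i : Fin m) (ξ : X) :
    ∑ l, ∫ η, κ i l ξ η * (u l η + ∑ j, ∫ ζ, resolventKernel μ κ l j η ζ * u j ζ ∂μ) ∂μ =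
      ∑ j, ∫ ζ, resolventKernel μ κ i j ξ ζ * u j ζ ∂μ := by
  have hleft : ∀ l,
      ∫ η, κ i l ξ η * (u l η + ∑ j, ∫ ζ, resolventKernel μ κ l j η ζ * u j ζ ∂μ) ∂μ =
        ∫ η, κ i l ξ η * u l η ∂μ +
          ∑ j, ∫ ζ, (∫ η, κ i l ξ η * resolventKernel μ κ l j η ζ ∂μ) * u j ζ ∂μ := by
    intro l
    have hint := fun j => hκ.integrable_mul_integral_resolvent i l j ξ (hu j)
    simp only [mul_add, Finset.mul_sum]
    rw [integral_add (hκ.integrable_mul i l ξ (hu l)) (integrable_finsetSum _ fun j _ => hint j),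
      integral_finsetSum _ fun j _ => hint j]
    simp only [hκ.integral_mul_integral_resolvent i l _ ξ (hu _)]
  have hright : ∀ j, ∫ ζ, resolventKernel μ κ i j ξ ζ * u j ζ ∂μ =
      ∫ ζ, κ i j ξ ζ * u j ζ ∂μ +
        ∑ l, ∫ ζ, (∫ η, κ i l ξ η * resolventKernel μ κ l j η ζ ∂μ) * u j ζ ∂μ := by
    intro j
    have hint := fun l => hκ.integrable_integral_mul_resolvent i l j ξ (hu j)
    simp only [hκ.resolventKernel_eq i j ξ, add_mul, Finset.sum_mul]
    rw [integral_add (hκ.integrable_mul i j ξ (hu j)) (integrable_finsetSum _ fun l _ => hint l),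
      integral_finsetSum _ fun l _ => hint l]
  simp only [hleft, hright, Finset.sum_add_distrib]
  rw [Finset.sum_comm]

theorem sum_integral_mul_eq_resolvent (hκ : IsTriangularKernel κ C)
    (hu : ∀ j, Integrable (u j) μ) (i : Fin m)
    (hv : ∀ l < i, ∀ᵐ ξ ∂μ, v l ξ = u l ξ + ∑ j, ∫ η, κ l j ξ η * v j η ∂μ) (ξ : X) :
    ∑ j, ∫ η, κ i j ξ η * v j η ∂μ = ∑ j, ∫ ζ, resolventKernel μ κ i j ξ ζ * u j ζ ∂μ := by
  induction i using WellFoundedLT.induction generalizing ξ with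
  | ind i ih =>
    rw [← hκ.sum_integral_mul_add_resolvent hu i ξ]
    refine Finset.sum_congr rfl fun l _ => integral_congr_ae ?_
    rcases lt_or_ge l i with hl | hl
    · filter_upwards [hv l hl] with η hη
      rw [hη, ih l hl (fun k hk => hv k (hk.trans hl)) η]
    · simp [hκ.eq_zero i l hl]

end IsTriangularKernel

end Resolvent

/-! ### Extension from the strip -/

section StripExtension

/-- The extension of a function from the strip `[0,+∞) × [0,1]` to the plane that is constant along
the nearest-point projection. -/
noncomputable def stripExtension (g : ℝ → ℝ → ℝ) (t x : ℝ) : ℝ :=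
  g (max t 0) (projIcc 0 1 zero_le_one x)

variable {g : ℝ → ℝ → ℝ}

theorem stripExtension_eq {t x : ℝ} (ht : 0 ≤ t) (hx : x ∈ Icc (0 : ℝ) 1) :
    stripExtension g t x = g t x := by
  rw [stripExtension, max_eq_left ht, projIcc_of_mem zero_le_one hx]

theorem forall_stripExtension {P : ℝ → Prop}
    (h : ∀ t x, 0 ≤ t → x ∈ Icc (0 : ℝ) 1 → P (g t x)) (t x : ℝ) : P (stripExtension g t x) :=
  h _ _ (le_max_right t 0) (projIcc 0 1 zero_le_one x).2

theorem continuous_stripExtension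
    (hg : ContinuousOn (fun q : ℝ × ℝ => g q.1 q.2) closedStrip) :
    Continuous fun q : ℝ × ℝ => stripExtension g q.1 q.2 :=
  hg.comp_continuous (f := fun q : ℝ × ℝ => (max q.1 0, (projIcc 0 1 zero_le_one q.2 : ℝ)))
    (by fun_prop) fun q => ⟨le_max_right q.1 0, (projIcc 0 1 zero_le_one q.2).2⟩

theorem lipschitzWith_stripExtension {K : ℝ≥0}
    (hg : ∀ t, 0 ≤ t → LipschitzOnWith K (g t) (Icc 0 1)) (t : ℝ) :
    LipschitzWith K (stripExtension g t) := by
  have hproj : LipschitzWith 1 fun x : ℝ => projIcc 0 1 zero_le_one x :=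
    LipschitzWith.projIcc zero_le_one
  exact mul_one K ▸ (lipschitzOnWith_iff_restrict.1 (hg _ (le_max_right t 0))).comp hproj

/-- A speed on the strip `[0,+∞) × [0,1]` that is uniformly bounded away from zero and whose
characteristics move to the left. -/
structure IsNegativeSpeed (l : ℝ → ℝ → ℝ) : Prop where
  continuousOn : ContinuousOn (fun q : ℝ × ℝ => l q.1 q.2) closedStrip
  lipschitzOnWith : ∃ K : ℝ≥0, ∀ t, 0 ≤ t → LipschitzOnWith K (l t) (Icc 0 1)
  norm_le : ∃ C : ℝ≥0, ∀ t x, 0 ≤ t → x ∈ Icc (0 : ℝ) 1 → ‖l t x‖ ≤ C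
  le_neg : ∃ ε : ℝ≥0, 0 < ε ∧ ∀ t x, 0 ≤ t → x ∈ Icc (0 : ℝ) 1 → l t x ≤ -ε

theorem IsNegativeSpeed.exists_negativeField {l : ℝ → ℝ → ℝ} (hl : IsNegativeSpeed l) :
    ∃ f : NegativeField, ∀ t x, 0 ≤ t → x ∈ Icc (0 : ℝ) 1 → f.velocity t x = l t x := by
  obtain ⟨K, hK⟩ := hl.lipschitzOnWith
  obtain ⟨C, hC⟩ := hl.norm_le
  obtain ⟨ε, hε, hle⟩ := hl.le_neg
  exact ⟨{  velocity := stripExtension l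
            lip := K
            bound := C
            continuous_velocity := fun x =>
              (continuous_stripExtension hl.continuousOn).comp (Continuous.prodMk_left x)
            lipschitzWith_velocity := lipschitzWith_stripExtension hK
            norm_velocity_le := forall_stripExtension (P := fun v => ‖v‖ ≤ C) hC
            gap := ε
            gap_pos := hε
            velocity_le := forall_stripExtension (P := fun v => v ≤ -ε) hle },
    fun _ _ => stripExtension_eq⟩

theorem AdmissibleSpeeds.isNegativeSpeed {m p : ℕ} {lam : ℝ → ℝ → Fin m ⊕ Fin p → ℝ}
    (h : AdmissibleSpeeds lam) (i : Fin m) : IsNegativeSpeed fun t x => lam t x (Sum.inl i) := by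
  obtain ⟨R, hR⟩ := h.bounded
  obtain ⟨ε, hε, hsep⟩ := h.separated
  have hcont := h.contDiff (Sum.inl i)
  refine ⟨hcont.continuousOn, ⟨R.toNNReal, fun t ht => ?_⟩, ⟨R.toNNReal, fun t x ht hx =>
    ((hR _ t x ht hx).1).trans (Real.le_coe_toNNReal R)⟩, ⟨ε.toNNReal, Real.toNNReal_pos.2 hε,
    fun t x ht hx => ?_⟩⟩
  · have hdiff : DifferentiableOn ℝ (fun x => lam t x (Sum.inl i)) (Icc 0 1) :=
      (hcont.differentiableOn one_ne_zero).comp (f := fun x : ℝ => (t, x)) (by fun_prop)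
        fun x hx => ⟨ht, hx⟩
    exact (convex_Icc 0 1).lipschitzOnWith_of_nnnorm_derivWithin_le hdiff fun x hx =>
      NNReal.coe_le_coe.1 (((hR _ t x ht hx).2).trans (Real.le_coe_toNNReal R))
  · rw [Real.coe_toNNReal ε hε.le]
    exact ((hsep t x ht hx).1 i).le

end StripExtension

/-! ### Source terms driven by the trace -/

theorem intervalIntegral_eq_indicator_Iio {E : Type*} [NormedAddCommGroup E] [NormedSpace ℝ E]
    {a b c : ℝ} {F : ℝ → E} (hab : a ≤ b) (hac : a ≤ c) (h : ∀ᵐ r, c < r → F r = 0) :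
    ∫ r in a..b, F r = ∫ r in a..c, (Iio b).indicator F r := by
  rw [intervalIntegral.integral_of_le hab, intervalIntegral.integral_of_le hac,
    integral_Ioc_eq_integral_Ioo, setIntegral_indicator measurableSet_Iio]
  refine setIntegral_eq_of_subset_of_ae_sdiff_eq_zero measurableSet_Ioo.nullMeasurableSet
    (fun r hr => ⟨hr.1.1, hr.2⟩) ?_
  filter_upwards [h] with r hr hmem
  exact hr (not_le.1 fun hrc => hmem.2 ⟨⟨hmem.1.1, hrc⟩, hmem.1.2⟩)

/-- The equations `∂ₜ yᵢ + λᵢ ∂ₓ yᵢ = ∑ⱼ gᵢⱼ(t, x) yⱼ(t, 0)` for `1 ≤ i ≤ m`, with negative speeds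
`λᵢ` (the velocity of `field i`) and a strictly lower triangular coupling matrix `g`. -/
structure TraceCoupledSystem (m : ℕ) where
  field : Fin m → NegativeField
  coupling : Fin m → Fin m → ℝ → ℝ → ℝ
  bound : ℝ≥0
  continuous_coupling : ∀ i j, Continuous fun q : ℝ × ℝ => coupling i j q.1 q.2
  norm_coupling_le : ∀ i j t x, ‖coupling i j t x‖ ≤ bound
  coupling_eq_zero : ∀ i j, i ≤ j → ∀ t x, coupling i j t x = 0

namespace TraceCoupledSystem

variable {m : ℕ} (S : TraceCoupledSystem m) {u : Fin m → ℝ → ℝ}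

/-- The right-hand side of the `i`-th equation, with traces `u`, along the characteristic through
`x` at time `t`. -/
noncomputable def forcing (u : Fin m → ℝ → ℝ) (i : Fin m) (t x r : ℝ) : ℝ :=
  ∑ j, S.coupling i j r ((S.field i).flow r t x) * u j r

/-- The solution of `∂ₜ wᵢ + λᵢ ∂ₓ wᵢ = ∑ⱼ gᵢⱼ uⱼ(t)`, `wᵢ(t, 0) = 0`. -/
noncomputable def source (u : Fin m → ℝ → ℝ) (i : Fin m) (t x : ℝ) : ℝ :=
  ∫ r in (S.field i).hit 0 t x..t, S.forcing u i t x r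

theorem continuous_coupling_flow (i j : Fin m) :
    Continuous fun q : (ℝ × ℝ) × ℝ =>
      S.coupling i j q.2 ((S.field i).flow q.2 q.1.1 q.1.2) :=
  (S.continuous_coupling i j).comp (continuous_snd.prodMk
    ((S.field i).continuous_flow.comp (continuous_snd.prodMk continuous_fst)))

theorem intervalIntegrable_coupling_mul (hu : ∀ j, LocallyIntegrable (u j)) (i j : Fin m)
    (t x a b : ℝ) :
    IntervalIntegrable (fun r => S.coupling i j r ((S.field i).flow r t x) * u j r) volume a b :=
  ((hu j).integrableOn_isCompact isCompact_uIcc).intervalIntegrable.continuousOn_mul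
    ((S.continuous_coupling_flow i j).comp (Continuous.prodMk_right (t, x))).continuousOn

theorem intervalIntegrable_forcing (hu : ∀ j, LocallyIntegrable (u j)) (i : Fin m)
    (t x a b : ℝ) : IntervalIntegrable (S.forcing u i t x) volume a b := by
  have hsum := IntervalIntegrable.sum Finset.univ
    fun j _ => S.intervalIntegrable_coupling_mul hu i j t x a b
  rwa [Finset.sum_fn] at hsum

@[simp] theorem source_zero (i : Fin m) (t : ℝ) : S.source u i t 0 = 0 := by
  simp [source]

theorem source_sub_source_flow (hu : ∀ j, LocallyIntegrable (u j)) (i : Fin m) (s t x : ℝ) :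
    S.source u i t x - S.source u i s ((S.field i).flow s t x) =
      ∫ r in s..t, S.forcing u i t x r := by
  simp only [source, forcing, NegativeField.hit_flow, LipschitzField.flow_flow]
  exact intervalIntegral.integral_interval_sub_left (S.intervalIntegrable_forcing hu i t x _ _)
    (S.intervalIntegrable_forcing hu i t x _ _)

theorem continuous_integral_forcing (hu : ∀ j, LocallyIntegrable (u j)) (i : Fin m) :
    Continuous fun q : (ℝ × ℝ) × ℝ => ∫ r in 0..q.2, S.forcing u i q.1.1 q.1.2 r := by
  refine continuous_iff_continuousAt.2 fun ⟨q, b⟩ => ?_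
  refine intervalIntegral.continuousAt_parametric_primitive_of_dominated
    (F := fun q : ℝ × ℝ => S.forcing u i q.1 q.2) (a₀ := 0) (b₀ := b)
    (fun r => ∑ j, S.bound * ‖u j r‖) (-(|b| + 1)) (|b| + 1) ?_ ?_ ?_ ?_ ?_ ?_ (by simp)
  · exact fun q => (S.intervalIntegrable_forcing hu i q.1 q.2 _ _).def'.aestronglyMeasurable
  · refine Eventually.of_forall fun q => Eventually.of_forall fun r => ?_
    refine (norm_sum_le _ _).trans (Finset.sum_le_sum fun j _ => ?_)
    rw [norm_mul]
    gcongr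
    exact S.norm_coupling_le i j _ _
  · simpa only [Finset.sum_fn] using IntervalIntegrable.sum Finset.univ fun j _ =>
      ((hu j).integrableOn_isCompact isCompact_uIcc).intervalIntegrable.norm.const_mul _
  · refine Eventually.of_forall fun r => Continuous.continuousAt ?_
    exact continuous_finsetSum _ fun j _ =>
      ((S.continuous_coupling_flow i j).comp (Continuous.prodMk_left r)).mul continuous_const
  · constructor <;> linarith [abs_nonneg b]
  · constructor <;> linarith [neg_abs_le b, le_abs_self b]

theorem continuous_source (hu : ∀ j, LocallyIntegrable (u j)) (i : Fin m) :
    Continuous fun q : ℝ × ℝ => S.source u i q.1 q.2 := by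
  have hhit : Continuous fun q : ℝ × ℝ => (S.field i).hit 0 q.1 q.2 :=
    (S.field i).continuous_hit.comp (Continuous.prodMk_right 0)
  have hprim := S.continuous_integral_forcing hu i
  refine ((hprim.comp (continuous_id.prodMk continuous_fst)).sub
    (hprim.comp (continuous_id.prodMk hhit))).congr fun q => ?_
  exact intervalIntegral.integral_interval_sub_left
    (S.intervalIntegrable_forcing hu i q.1 q.2 _ _) (S.intervalIntegrable_forcing hu i q.1 q.2 _ _)

open Classical in
/-- The integral kernel that recovers `source` at time `s` from the values at time `s` of functions
that are transported along the characteristics: `η` stands for the trace at the time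
`r = hit 0 s η`, and the derivative is the Jacobian of this substitution. -/
noncomputable def kernel (s : ℝ) (i j : Fin m) (ξ η : ℝ) : ℝ :=
  if η ∈ Ioo 0 1 ∧ (S.field j).hit 0 s η < (S.field i).hit 0 s ξ then
    S.coupling i j ((S.field j).hit 0 s η) ((S.field i).flow ((S.field j).hit 0 s η) s ξ) *
      deriv ((S.field j).hit 0 s) η
  else 0

/-- A bound of `kernel`, uniform in time. -/
noncomputable def kernelBound : ℝ≥0 :=
  S.bound * ∑ k, (S.field k).distortion / (S.field k).gap

theorem measurable_kernel (i j : Fin m) :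
    Measurable fun q : ℝ × ℝ × ℝ => S.kernel q.1 i j q.2.1 q.2.2 := by
  have hhit : ∀ k, Continuous fun q : ℝ × ℝ => (S.field k).hit 0 q.1 q.2 := fun k =>
    (S.field k).continuous_hit.comp (Continuous.prodMk_right 0)
  have hhitj : Continuous fun q : ℝ × ℝ × ℝ => (S.field j).hit 0 q.1 q.2.2 :=
    (hhit j).comp (f := fun q : ℝ × ℝ × ℝ => (q.1, q.2.2)) (by fun_prop)
  have hhiti : Continuous fun q : ℝ × ℝ × ℝ => (S.field i).hit 0 q.1 q.2.1 :=
    (hhit i).comp (f := fun q : ℝ × ℝ × ℝ => (q.1, q.2.1)) (by fun_prop)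
  have hcoef := (S.continuous_coupling_flow i j).comp
    (f := fun q : ℝ × ℝ × ℝ => ((q.1, q.2.1), (S.field j).hit 0 q.1 q.2.2)) (by fun_prop)
  have hderiv := (measurable_deriv_with_param (f := (S.field j).hit 0) (hhit j)).comp
    (f := fun q : ℝ × ℝ × ℝ => (q.1, q.2.2)) (by fun_prop)
  exact Measurable.ite ((measurableSet_Ioo.preimage (measurable_snd.comp measurable_snd)).inter
    (measurableSet_lt hhitj.measurable hhiti.measurable)) (hcoef.measurable.mul hderiv)
    measurable_const

theorem norm_kernel_le (s : ℝ) (i j : Fin m) (ξ η : ℝ) :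
    ‖S.kernel s i j ξ η‖ ≤ S.kernelBound := by
  rw [kernel]
  split_ifs with h
  · have hderiv : ‖deriv ((S.field j).hit 0 s) η‖ ≤
        ((S.field j).distortion / (S.field j).gap : ℝ≥0) :=
      norm_deriv_le_of_lipschitzOn (Icc_mem_nhds h.1.1 h.1.2) ((S.field j).lipschitzOnWith_hit s)
    have hsum : (S.field j).distortion / (S.field j).gap ≤
        ∑ k, (S.field k).distortion / (S.field k).gap :=
      Finset.single_le_sum (f := fun k => (S.field k).distortion / (S.field k).gap)
        (fun _ _ => zero_le) (Finset.mem_univ j)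
    rw [norm_mul, kernelBound, NNReal.coe_mul]
    gcongr
    exacts [S.norm_coupling_le i j _ _, hderiv.trans (NNReal.coe_le_coe.2 hsum)]
  · simp

theorem isTriangularKernel_kernel (s : ℝ) : IsTriangularKernel (S.kernel s) S.kernelBound where
  measurable i j := (S.measurable_kernel i j).comp measurable_prodMk_left
  norm_le := S.norm_kernel_le s
  eq_zero i j hij ξ η := by simp [kernel, S.coupling_eq_zero i j hij]

theorem integral_coupling_mul_eq_kernel (i j : Fin m) {s ξ : ℝ} (hξ : 0 ≤ ξ)
    (hu : ∀ᵐ r, (S.field j).hit 0 s 1 < r → u j r = 0) :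
    ∫ r in s..(S.field i).hit 0 s ξ, S.coupling i j r ((S.field i).flow r s ξ) * u j r =
      ∫ η in Ioo 0 1, S.kernel s i j ξ η * u j ((S.field j).hit 0 s η) := by
  set F := fun r => S.coupling i j r ((S.field i).flow r s ξ) * u j r
  have hle : ∀ k {x : ℝ}, 0 ≤ x → s ≤ (S.field k).hit 0 s x := fun k x hx => by
    simpa only [NegativeField.le_hit_iff, LipschitzField.flow_self] using hx
  have hvanish : ∀ᵐ r, (S.field j).hit 0 s 1 < r → F r = 0 := by
    filter_upwards [hu] with r hr h
    rw [show F r = _ * u j r from rfl, hr h, mul_zero]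
  have hsubst := integral_eq_integral_deriv_smul_of_lipschitzOnWith zero_le_one
    (((S.field j).strictMono_hit 0 s).strictMonoOn _) ((S.field j).lipschitzOnWith_hit s)
    ((Iio ((S.field i).hit 0 s ξ)).indicator F)
  rw [NegativeField.hit_self] at hsubst
  rw [intervalIntegral_eq_indicator_Iio (hle i hξ) (hle j zero_le_one) hvanish, hsubst,
    intervalIntegral.integral_of_le zero_le_one, integral_Ioc_eq_integral_Ioo]
  refine setIntegral_congr_fun measurableSet_Ioo fun η hη => ?_
  by_cases h : (S.field j).hit 0 s η < (S.field i).hit 0 s ξ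
  · simp only [kernel, hη, h, and_self, if_true, mem_Iio, indicator_of_mem, smul_eq_mul, F]
    ring
  · simp [kernel, h]

theorem source_eq_neg_sum_kernel (hu : ∀ j, LocallyIntegrable (u j)) {i : Fin m} {s ξ : ℝ}
    (hξ : 0 ≤ ξ) (hzero : ∀ j < i, ∀ᵐ r, (S.field j).hit 0 s 1 < r → u j r = 0) :
    S.source u i s ξ =
      -∑ j, ∫ η in Ioo 0 1, S.kernel s i j ξ η * u j ((S.field j).hit 0 s η) := by
  rw [source, intervalIntegral.integral_symm]
  simp only [forcing]
  rw [intervalIntegral.integral_finsetSum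
    fun j _ => S.intervalIntegrable_coupling_mul hu i j s ξ _ _]
  congr 1
  refine Finset.sum_congr rfl fun j _ => ?_
  rcases lt_or_ge j i with hji | hij
  · exact S.integral_coupling_mul_eq_kernel i j hξ (hzero j hji)
  · simp [S.coupling_eq_zero i j hij, (S.isTriangularKernel_kernel s).eq_zero i j hij]

end TraceCoupledSystem

/-! ### Functions constant along the characteristics -/

namespace NegativeField

variable (f : NegativeField) {t0 : ℝ} {z0 c : ℝ → ℝ}

/-- The solution of `∂ₜ z + λ ∂ₓ z = 0` with initial value `z0` at time `t0` and boundary values `c`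
at `x = 1`. -/
noncomputable def transport (t0 : ℝ) (z0 c : ℝ → ℝ) (t x : ℝ) : ℝ :=
  if t0 < f.hit 1 t x then c (f.hit 1 t x) else z0 (f.flow t0 t x)

theorem transport_hit (t x : ℝ) :
    f.transport t0 z0 c (f.hit 0 t x) 0 = f.transport t0 z0 c t x := by
  simp only [transport, f.hit_hit, f.flow_hit_base]

theorem transport_initial {x : ℝ} (hx : x ≤ 1) : f.transport t0 z0 c t0 x = z0 x := by
  have hhit : f.hit 1 t0 x ≤ t0 := f.hit_le_iff.2 (by rwa [f.flow_self])
  rw [transport, if_neg hhit.not_gt, f.flow_self]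

theorem hit_lt_iff_lt_hit {a b s t : ℝ} : f.hit a s b < t ↔ s < f.hit b t a := by
  rw [f.hit_lt_iff, f.lt_hit_iff, ← (f.strictMono_flow s t).lt_iff_lt, f.flow_flow, f.flow_self]

theorem lt_hit_zero {s x : ℝ} (hx : 0 < x) : s < f.hit 0 s x :=
  f.lt_hit_iff.2 (by rwa [f.flow_self])

theorem ae_comp_hit {P : ℝ → Prop} {s : ℝ} (hP : ∀ᵐ τ ∂volume.restrict (Ioi s), P τ) :
    ∀ᵐ ξ ∂volume.restrict (Ioo 0 1), P (f.hit 0 s ξ) := by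
  rw [restrict_Ioi_eq_restrict_Ici] at hP
  refine ae_restrict_of_ae_restrict_of_subset Ioo_subset_Icc_self ?_
  exact ae_comp_of_antilipschitz (f.strictMono_hit 0 s).monotone.measurable measurableSet_Icc
    (fun ξ hξ => f.le_hit_iff.2 (by rw [f.flow_self]; exact hξ.1))
    (f.antilipschitzWith_restrict_hit s) hP

end NegativeField

namespace HasBroadRegularity

variable {m p : ℕ} {t0 : ℝ} {y : ℝ → ℝ → HypState m p} (hy : HasBroadRegularity t0 y)
  {f : NegativeField} {i : Fin m ⊕ Fin p} {z0 c : ℝ → ℝ}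
include hy

theorem memLp_space_apply (i : Fin m ⊕ Fin p) {t : ℝ} (ht : t0 ≤ t) :
    MemLp (fun x => y t x i) 2 (volume.restrict (Ioo (0 : ℝ) 1)) :=
  (EuclideanSpace.proj (𝕜 := ℝ) i).comp_memLp' (hy.memLp_space t ht)

theorem memLp_time_apply (i : Fin m ⊕ Fin p) {T x : ℝ} (hT : 0 < T) (hx : x ∈ Icc (0 : ℝ) 1) :
    MemLp (fun t => y t x i) 2 (volume.restrict (Ioo t0 (t0 + T))) :=
  (EuclideanSpace.proj (𝕜 := ℝ) i).comp_memLp' (hy.memLp_time T hT x hx)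

theorem ae_trace_eq_transport
    (h : ∀ᵐ q ∂volume.restrict (Ioi t0 ×ˢ Ioo (0 : ℝ) 1),
      y q.1 q.2 i = f.transport t0 z0 c q.1 q.2) :
    ∀ᵐ τ ∂volume.restrict (Ioi t0), y τ 0 i = f.transport t0 z0 c τ 0 := by
  refine f.ae_eq_trace (z := fun t x => y t x i) (β := fun τ => f.transport t0 z0 c τ 0)
    (h.mono fun q hq => hq.trans (f.transport_hit q.1 q.2).symm)
    (fun T hT x hx => hy.memLp_time_apply i hT hx) fun T hT => ?_
  exact tendsto_of_tendsto_of_tendsto_of_le_of_le tendsto_const_nhds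
    (hy.continuous_space T hT 0 (left_mem_Icc.2 zero_le_one)) (fun _ => zero_le)
    fun x => eLpNorm_mono fun t => PiLp.norm_apply_le (y t x - y t 0) i

theorem ae_section_eq_transport
    (h : ∀ᵐ q ∂volume.restrict (Ioi t0 ×ˢ Ioo (0 : ℝ) 1),
      y q.1 q.2 i = f.transport t0 z0 c q.1 q.2) {s : ℝ} (hs : t0 ≤ s) :
    ∀ᵐ ξ ∂volume.restrict (Ioo 0 1), y s ξ i = f.transport t0 z0 c s ξ := by
  simp only [← f.transport_hit s]
  refine f.ae_eq_section (z := fun t x => y t x i) (β := fun τ => f.transport t0 z0 c τ 0)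
    (h.mono fun q hq => hq.trans (f.transport_hit q.1 q.2).symm)
    (fun s hs => hy.memLp_space_apply i hs) hs ?_
  exact tendsto_of_tendsto_of_tendsto_of_le_of_le tendsto_const_nhds
    (hy.continuous_time s hs) (fun _ => zero_le)
    fun r => eLpNorm_mono fun x => PiLp.norm_apply_le (y r x - y s x) i

end HasBroadRegularity

/-! ### Subtracting a continuous function -/

section Continuous

variable {E : Type*} [NormedAddCommGroup E] {a b : ℝ}

theorem memLp_Ioo_of_continuous {W : ℝ → E} (hW : Continuous W) :
    MemLp W 2 (volume.restrict (Ioo a b)) := by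
  obtain ⟨C, hC⟩ := isCompact_Icc.exists_bound_of_continuousOn (s := Icc a b) hW.continuousOn
  exact MemLp.of_bound hW.aestronglyMeasurable C
    (ae_restrict_of_forall_mem measurableSet_Ioo fun x hx => hC x (Ioo_subset_Icc_self hx))

theorem tendsto_eLpNorm_sub_of_continuous {W : ℝ → ℝ → E}
    (hW : Continuous fun q : ℝ × ℝ => W q.1 q.2) (t : ℝ) :
    Tendsto (fun s => eLpNorm (fun x => W s x - W t x) 2 (volume.restrict (Ioo a b))) (𝓝 t)
      (𝓝 0) := by
  have hdiff : Continuous fun q : ℝ × ℝ => W q.1 q.2 - W t q.2 :=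
    hW.sub (hW.comp (continuous_const.prodMk continuous_snd))
  have hsection (s : ℝ) : Continuous fun x => W s x - W t x :=
    hdiff.comp (Continuous.prodMk_right s)
  obtain ⟨C, hC⟩ := (isCompact_Icc.prod isCompact_Icc).exists_bound_of_continuousOn
    (s := Icc (t - 1) (t + 1) ×ˢ Icc a b) hdiff.continuousOn
  refine tendsto_eLpNorm_zero_of_bounded (by simp) (by simp)
    (.of_forall fun s => (hsection s).aestronglyMeasurable) (C := C) ?_ (.of_forall fun x => ?_)
  · filter_upwards [Icc_mem_nhds (sub_one_lt t) (lt_add_one t)] with s hs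
    exact ae_restrict_of_forall_mem measurableSet_Ioo
      fun x hx => hC (s, x) ⟨hs, Ioo_subset_Icc_self hx⟩
  · simpa using (show Continuous fun s => W s x - W t x from
      hdiff.comp (Continuous.prodMk_left x)).tendsto t

theorem tendsto_eLpNorm_sub_sub_of_continuous {y W : ℝ → ℝ → E} {s : Set ℝ} {t : ℝ}
    (hy : ∀ r ∈ s, AEStronglyMeasurable (y r) (volume.restrict (Ioo a b))) (ht : t ∈ s)
    (hlim : Tendsto (fun r => eLpNorm (fun x => y r x - y t x) 2 (volume.restrict (Ioo a b)))
      (𝓝[s] t) (𝓝 0)) (hW : Continuous fun q : ℝ × ℝ => W q.1 q.2) :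
    Tendsto (fun r => eLpNorm (fun x => (y r x - W r x) - (y t x - W t x)) 2
      (volume.restrict (Ioo a b))) (𝓝[s] t) (𝓝 0) := by
  have hsum := hlim.add
    ((tendsto_eLpNorm_sub_of_continuous (a := a) (b := b) hW t).mono_left nhdsWithin_le_nhds)
  rw [add_zero] at hsum
  have hmeas (r : ℝ) : Continuous (W r) := hW.comp (Continuous.prodMk_right r)
  refine tendsto_of_tendsto_of_tendsto_of_le_of_le' tendsto_const_nhds hsum
    (.of_forall fun _ => zero_le) ?_
  filter_upwards [self_mem_nhdsWithin] with r hr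
  simp only [sub_sub_sub_comm (y r _)]
  exact eLpNorm_sub_le ((hy r hr).sub (hy t ht))
    ((hmeas r).sub (hmeas t)).aestronglyMeasurable one_le_two

theorem HasBroadRegularity.sub_continuous {m p : ℕ} {t0 : ℝ} {y W : ℝ → ℝ → HypState m p}
    (hy : HasBroadRegularity t0 y) (hW : Continuous fun q : ℝ × ℝ => W q.1 q.2) :
    HasBroadRegularity t0 fun t x => y t x - W t x where
  measurable := hy.measurable.sub hW.aestronglyMeasurable
  memLp_space t ht := (hy.memLp_space t ht).sub
    (memLp_Ioo_of_continuous (hW.comp (Continuous.prodMk_right t)))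
  continuous_time t ht := tendsto_eLpNorm_sub_sub_of_continuous
    (fun s hs => (hy.memLp_space s hs).1) ht (hy.continuous_time t ht) hW
  memLp_time T hT x hx := (hy.memLp_time T hT x hx).sub
    (memLp_Ioo_of_continuous (hW.comp (Continuous.prodMk_left x)))
  continuous_space T hT x hx := tendsto_eLpNorm_sub_sub_of_continuous
    (y := fun x t => y t x) (W := fun x t => W t x) (fun x' hx' => (hy.memLp_time T hT x' hx').1) hx
    (hy.continuous_space T hT x hx) (hW.comp continuous_swap)

end Continuous

/-! ### Integral operators with bounded kernels -/

section KernelBound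

variable {X ι J : Type*} [MeasurableSpace X] [Fintype ι] [Fintype J] {μ : Measure X}

theorem norm_sum_integral_mul_le {k : ι → X → ℝ} {C : ℝ≥0} (hk : ∀ i η, ‖k i η‖ ≤ C)
    {z : X → EuclideanSpace ℝ J} (hz : Integrable z μ) (e : ι → J) :
    ‖∑ i, ∫ η, k i η * z η (e i) ∂μ‖ ≤ Fintype.card ι * C * ∫ η, ‖z η‖ ∂μ := by
  have hterm (i : ι) : ‖∫ η, k i η * z η (e i) ∂μ‖ ≤ C * ∫ η, ‖z η‖ ∂μ := by
    rw [← integral_const_mul]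
    refine norm_integral_le_of_norm_le (hz.norm.const_mul _) (.of_forall fun η => ?_)
    rw [norm_mul]
    exact mul_le_mul (hk i η) (PiLp.norm_apply_le (z η) (e i)) (norm_nonneg _) C.coe_nonneg
  calc ‖∑ i, ∫ η, k i η * z η (e i) ∂μ‖ ≤ ∑ _i : ι, C * ∫ η, ‖z η‖ ∂μ :=
        norm_sum_le_of_le _ fun i _ => hterm i
    _ = Fintype.card ι * C * ∫ η, ‖z η‖ ∂μ := by
        rw [Finset.sum_const, Finset.card_univ, nsmul_eq_mul, mul_assoc]

theorem norm_le_card_mul_of_norm_apply_le {v : EuclideanSpace ℝ J} {K : ℝ} (hK : 0 ≤ K)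
    (hv : ∀ i, ‖v i‖ ≤ K) : ‖v‖ ≤ Fintype.card J * K := by
  rw [EuclideanSpace.norm_eq]
  refine Real.sqrt_le_iff.2 ⟨by positivity, ?_⟩
  calc ∑ i, ‖v i‖ ^ 2 ≤ (∑ i, ‖v i‖) ^ 2 :=
        Finset.sum_sq_le_sq_sum_of_nonneg fun _ _ => norm_nonneg _
    _ ≤ (∑ _i : J, K) ^ 2 := by gcongr with i; exact hv i
    _ = (Fintype.card J * K) ^ 2 := by rw [Finset.sum_const, Finset.card_univ, nsmul_eq_mul]

theorem eLpNorm_le_of_norm_apply_le_integral [IsProbabilityMeasure μ] {E : Type*}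
    [NormedAddCommGroup E] {w : X → EuclideanSpace ℝ J} {z : X → E} {C : ℝ≥0} (hz : MemLp z 2 μ)
    (h : ∀ᵐ ξ ∂μ, ∀ i, ‖w ξ i‖ ≤ C * ∫ η, ‖z η‖ ∂μ) :
    eLpNorm w 2 μ ≤ (Fintype.card J * C : ℝ≥0) * eLpNorm z 2 μ := by
  have hmean : ENNReal.ofReal (∫ η, ‖z η‖ ∂μ) ≤ eLpNorm z 2 μ := by
    rw [ofReal_integral_norm_eq_lintegral_enorm (hz.integrable one_le_two),
      ← eLpNorm_one_eq_lintegral_enorm]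
    exact eLpNorm_le_eLpNorm_of_exponent_le one_le_two hz.1
  have hbound : ∀ᵐ ξ ∂μ, ‖w ξ‖ ≤ (Fintype.card J * C : ℝ≥0) * ∫ η, ‖z η‖ ∂μ := by
    filter_upwards [h] with ξ hξ
    refine (norm_le_card_mul_of_norm_apply_le (by positivity) hξ).trans_eq ?_
    push_cast
    ring
  refine (eLpNorm_le_of_ae_bound hbound).trans ?_
  rw [measure_univ, ENNReal.one_rpow, one_mul, ENNReal.ofReal_mul (NNReal.coe_nonneg _),
    ENNReal.ofReal_coe_nnreal]
  gcongr

end KernelBound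

/-! ### The backstepping transformation -/

theorem locallyIntegrable_indicator_of_memLp {E : Type*} [NormedAddCommGroup E] {t0 : ℝ}
    {v : ℝ → E} (hv : ∀ T > 0, MemLp v 2 (volume.restrict (Ioo t0 (t0 + T)))) :
    LocallyIntegrable ((Ioi t0).indicator v) := by
  refine locallyIntegrable_iff.2 fun K hK => ?_
  obtain ⟨b, hb⟩ := hK.isBounded.bddAbove
  have hint : IntegrableOn v (Ioo t0 (t0 + max 1 (b - t0 + 1))) :=
    (hv _ (by positivity)).integrable one_le_two
  rw [integrableOn_indicator_iff measurableSet_Ioi]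
  refine hint.mono_set fun r hr => ⟨hr.1, ?_⟩
  linarith [hb hr.2, le_max_right 1 (b - t0 + 1)]

section ZeroTrace

variable {m p : ℕ} {t0 : ℝ} {y : ℝ → ℝ → HypState m p}

/-- The traces `y₋(·, 0)`, extended by zero to the times before `t0`. -/
noncomputable def zeroTrace (t0 : ℝ) (y : ℝ → ℝ → HypState m p) (j : Fin m) : ℝ → ℝ :=
  (Ioi t0).indicator fun r => y r 0 (Sum.inl j)

theorem locallyIntegrable_zeroTrace (hy : HasBroadRegularity t0 y) (j : Fin m) :
    LocallyIntegrable (zeroTrace t0 y j) :=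
  locallyIntegrable_indicator_of_memLp fun _ hT =>
    hy.memLp_time_apply _ hT (left_mem_Icc.2 zero_le_one)

end ZeroTrace

namespace TraceCoupledSystem

variable {m p : ℕ} (S : TraceCoupledSystem m) {t0 : ℝ} {y : ℝ → ℝ → HypState m p}

/-- The state whose negative-speed components are the solutions `source` for the traces of `y`, and
whose other components vanish. -/
noncomputable def sourceState (t0 : ℝ) (y : ℝ → ℝ → HypState m p) (t x : ℝ) : HypState m p :=
  WithLp.toLp 2 (Sum.elim (fun i => S.source (zeroTrace t0 y) i t x) 0)

@[simp] theorem sourceState_inl (t x : ℝ) (i : Fin m) :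
    S.sourceState t0 y t x (Sum.inl i) = S.source (zeroTrace t0 y) i t x := rfl

@[simp] theorem sourceState_inr (t x : ℝ) (k : Fin p) :
    S.sourceState t0 y t x (Sum.inr k) = 0 := rfl

theorem sourceState_zero (t : ℝ) : S.sourceState t0 y t 0 = 0 := by
  ext (i | k) <;> simp

theorem continuous_sourceState (hy : HasBroadRegularity t0 y) :
    Continuous fun q : ℝ × ℝ => S.sourceState t0 y q.1 q.2 := by
  refine (PiLp.continuous_toLp 2 _).comp (continuous_pi ?_)
  rintro (i | _)
  exacts [S.continuous_source (locallyIntegrable_zeroTrace hy) i, continuous_const]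

theorem continuous_sourceState_apply (hy : HasBroadRegularity t0 y) (t : ℝ) :
    Continuous (S.sourceState t0 y t) :=
  (S.continuous_sourceState hy).comp (Continuous.prodMk_right t)

theorem eLpNorm_sourceState_le {C : ℝ≥0} {k : Fin m → Fin m → ℝ → ℝ → ℝ} {s : ℝ}
    {z : ℝ → HypState m p} (hk : ∀ i j ξ η, ‖k i j ξ η‖ ≤ C)
    (hz : MemLp z 2 (volume.restrict (Ioo 0 1)))
    (h : ∀ i, ∀ ξ ∈ Ioo (0 : ℝ) 1, S.source (zeroTrace t0 y) i s ξ =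
      -∑ j, ∫ η in Ioo 0 1, k i j ξ η * z η (Sum.inl j)) :
    eLpNorm (S.sourceState t0 y s) 2 (volume.restrict (Ioo 0 1)) ≤
      ((m + p : ℕ) * (m * C) : ℝ≥0) * eLpNorm z 2 (volume.restrict (Ioo 0 1)) := by
  have hprob : IsProbabilityMeasure (volume.restrict (Ioo (0 : ℝ) 1)) := ⟨by simp⟩
  have hbound := eLpNorm_le_of_norm_apply_le_integral (w := S.sourceState t0 y s) (C := m * C) hz
    (ae_restrict_of_forall_mem measurableSet_Ioo fun ξ hξ i => ?_)
  · simpa using hbound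
  rcases i with i | i
  · rw [sourceState_inl, h i ξ hξ, norm_neg]
    simpa using norm_sum_integral_mul_le (hk i · ξ) (hz.integrable one_le_two) Sum.inl
  · rw [sourceState_inr, norm_zero]
    positivity

/-- The backstepping transformation: what remains of `y` when the contribution of the couplings to
the traces is removed. -/
noncomputable def reduce (t0 : ℝ) (y : ℝ → ℝ → HypState m p) (t x : ℝ) : HypState m p :=
  y t x - S.sourceState t0 y t x

theorem reduce_zero (t : ℝ) : S.reduce t0 y t 0 = y t 0 := by
  rw [reduce, sourceState_zero, sub_zero]

theorem hasBroadRegularity_reduce (hy : HasBroadRegularity t0 y) :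
    HasBroadRegularity t0 (S.reduce t0 y) :=
  hy.sub_continuous (S.continuous_sourceState hy)

/-! ### The feedback law -/

/-- The resolvent of the kernel at time `s`; it recovers `source` from the state itself. -/
noncomputable def resolvent (s : ℝ) : Fin m → Fin m → ℝ → ℝ → ℝ :=
  resolventKernel (volume.restrict (Ioo 0 1)) (S.kernel s)

theorem exists_norm_resolvent_le : ∃ D : ℝ≥0, ∀ s i j ξ ζ, ‖S.resolvent s i j ξ ζ‖ ≤ D := by
  obtain ⟨D, hD⟩ := exists_norm_resolventKernel_le (volume.restrict (Ioo (0 : ℝ) 1)) m S.kernelBound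
  exact ⟨D, fun s => hD _ (S.norm_kernel_le s)⟩

/-- The feedback matrix `F`, acting on the components with negative speeds. -/
noncomputable def feedback (s ζ : ℝ) : Matrix (Fin m) (Fin m ⊕ Fin p) ℝ :=
  Matrix.of fun i => Sum.elim (fun j => -S.resolvent s i j 1 ζ) 0

/-- The boundary value `∫₀¹ F(s, ξ) z(ξ) dξ` prescribed by `feedback` at time `s`. -/
noncomputable def feedbackValue (s : ℝ) (z : ℝ → HypState m p) (i : Fin m) : ℝ :=
  -∑ j, ∫ ξ in Ioo 0 1, S.resolvent s i j 1 ξ * z ξ (Sum.inl j)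

theorem boundaryValue_feedback (Q : ℝ → Matrix (Fin p) (Fin m) ℝ) (s : ℝ) (i : Fin m) :
    boundaryValue S.feedback Q y s (Sum.inl i) = S.feedbackValue s (y s) i := by
  simp [boundaryValue, feedback, feedbackValue, intervalIntegral.integral_of_le,
    integral_Ioc_eq_integral_Ioo, integral_neg]

theorem isLInftyMatrix_feedback : IsLInftyMatrix (S.feedback (p := p)) := by
  obtain ⟨D, hD⟩ := S.exists_norm_resolvent_le
  rintro i (j | _)
  · have hmeas : Measurable fun q : ℝ × ℝ => S.resolvent q.1 i j 1 q.2 :=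
      (measurable_resolventKernel S.measurable_kernel i j).comp
        (f := fun q : ℝ × ℝ => (q.1, 1, q.2)) (by fun_prop)
    exact memLp_top_of_bound hmeas.neg.aestronglyMeasurable D
      (.of_forall fun q => (norm_neg _).trans_le (hD _ _ _ _ _))
  · exact MemLp.zero'

end TraceCoupledSystem

/-! ### The closed loop -/

namespace TraceCoupledSystem

/-- `y` solves, with initial state `y0` at time `t0`, the equations of `S` for the components with
negative speeds, with boundary values prescribed by the feedback. The equations are stated for
`reduce`, which is constant along the characteristics. -/
structure IsClosedLoopSolution {m p : ℕ} (S : TraceCoupledSystem m) (t0 : ℝ) (y0 : ℝ → HypState m p)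
    (y : ℝ → ℝ → HypState m p) : Prop where
  regularity : HasBroadRegularity t0 y
  transport : ∀ᵐ q ∂volume.restrict (Ioi t0 ×ˢ Ioo (0 : ℝ) 1), ∀ i : Fin m,
    S.reduce t0 y q.1 q.2 (Sum.inl i) = (S.field i).transport t0
      (fun x => (y0 x - S.sourceState t0 y t0 x) (Sum.inl i))
      (fun s => S.feedbackValue s (y s) i - S.source (zeroTrace t0 y) i s 1) q.1 q.2

namespace IsClosedLoopSolution

variable {m p : ℕ} {S : TraceCoupledSystem m} {t0 : ℝ} {y0 : ℝ → HypState m p}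
  {y : ℝ → ℝ → HypState m p} (hy : S.IsClosedLoopSolution t0 y0 y)
include hy

theorem ae_trace_eq_transport (i : Fin m) : ∀ᵐ τ ∂volume.restrict (Ioi t0),
    zeroTrace t0 y i τ = (S.field i).transport t0
      (fun x => (y0 x - S.sourceState t0 y t0 x) (Sum.inl i))
      (fun s => S.feedbackValue s (y s) i - S.source (zeroTrace t0 y) i s 1) τ 0 := by
  filter_upwards [(S.hasBroadRegularity_reduce hy.regularity).ae_trace_eq_transport
    (hy.transport.mono fun _ hq => hq i), ae_restrict_mem measurableSet_Ioi] with τ hτ hmem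
  rw [zeroTrace, indicator_of_mem hmem, ← S.reduce_zero (t0 := t0) (y := y), hτ]

theorem ae_section_eq_transport (i : Fin m) {s : ℝ} (hs : t0 ≤ s) :
    ∀ᵐ ξ ∂volume.restrict (Ioo 0 1),
      S.reduce t0 y s ξ (Sum.inl i) = (S.field i).transport t0
        (fun x => (y0 x - S.sourceState t0 y t0 x) (Sum.inl i))
        (fun s => S.feedbackValue s (y s) i - S.source (zeroTrace t0 y) i s 1) s ξ :=
  (S.hasBroadRegularity_reduce hy.regularity).ae_section_eq_transport
    (hy.transport.mono fun _ hq => hq i) hs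

theorem ae_initial_eq :
    ∀ᵐ ξ ∂volume.restrict (Ioo 0 1), ∀ i : Fin m, y t0 ξ (Sum.inl i) = y0 ξ (Sum.inl i) := by
  refine ae_all_iff.2 fun i => ?_
  filter_upwards [hy.ae_section_eq_transport i le_rfl, ae_restrict_mem measurableSet_Ioo]
    with ξ hξ hmem
  rw [NegativeField.transport_initial _ hmem.2.le] at hξ
  exact sub_left_injective hξ

theorem ae_zeroTrace_hit_eq (i : Fin m) {s : ℝ} (hs : t0 ≤ s) :
    ∀ᵐ ξ ∂volume.restrict (Ioo 0 1),
      zeroTrace t0 y i ((S.field i).hit 0 s ξ) = S.reduce t0 y s ξ (Sum.inl i) := by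
  filter_upwards [(S.field i).ae_comp_hit (ae_restrict_of_ae_restrict_of_subset
    (Ioi_subset_Ioi hs) (hy.ae_trace_eq_transport i)), hy.ae_section_eq_transport i hs]
    with ξ htrace hsection
  rw [htrace, hsection, NegativeField.transport_hit]

theorem ae_zeroTrace_eq_zero {i : Fin m}
    (hi : ∀ s, t0 ≤ s → S.feedbackValue s (y s) i = S.source (zeroTrace t0 y) i s 1) :
    ∀ᵐ r, (S.field i).hit 0 t0 1 < r → zeroTrace t0 y i r = 0 := by
  filter_upwards [(ae_restrict_iff' measurableSet_Ioi).1 (hy.ae_trace_eq_transport i)]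
    with r hr hlt
  have hentry : t0 < (S.field i).hit 1 r 0 := (S.field i).hit_lt_iff_lt_hit.1 hlt
  rw [hr (((S.field i).lt_hit_zero one_pos).trans hlt), NegativeField.transport, if_pos hentry,
    hi _ hentry.le, sub_self]

theorem source_eq_neg_sum_reduce {i : Fin m}
    (hlow : ∀ j < i, ∀ s, t0 ≤ s → S.feedbackValue s (y s) j = S.source (zeroTrace t0 y) j s 1)
    {s ξ : ℝ} (hs : t0 ≤ s) (hξ : 0 ≤ ξ) :
    S.source (zeroTrace t0 y) i s ξ =
      -∑ j, ∫ η in Ioo 0 1, S.kernel s i j ξ η * S.reduce t0 y s η (Sum.inl j) := by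
  rw [S.source_eq_neg_sum_kernel (locallyIntegrable_zeroTrace hy.regularity) hξ]
  · congr 1
    refine Finset.sum_congr rfl fun j _ => integral_congr_ae ?_
    filter_upwards [hy.ae_zeroTrace_hit_eq j hs] with η hη
    rw [hη]
  · intro j hj
    have hmono : (S.field j).hit 0 t0 1 ≤ (S.field j).hit 0 s 1 := by
      rw [← not_lt, NegativeField.hit_lt_iff_lt_hit, NegativeField.hit_hit, NegativeField.hit_self]
      exact hs.not_gt
    filter_upwards [hy.ae_zeroTrace_eq_zero (hlow j hj)] with r hr hlt
    exact hr (hmono.trans_lt hlt)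

theorem source_eq_neg_sum_resolvent {i : Fin m}
    (hlow : ∀ j < i, ∀ s, t0 ≤ s → S.feedbackValue s (y s) j = S.source (zeroTrace t0 y) j s 1)
    {s ξ : ℝ} (hs : t0 ≤ s) (hξ : 0 ≤ ξ) :
    S.source (zeroTrace t0 y) i s ξ =
      -∑ j, ∫ η in Ioo 0 1, S.resolvent s i j ξ η * y s η (Sum.inl j) := by
  rw [hy.source_eq_neg_sum_reduce hlow hs hξ, resolvent]
  congr 1
  refine (S.isTriangularKernel_kernel s).sum_integral_mul_eq_resolvent
    (u := fun j η => y s η (Sum.inl j)) (v := fun j η => S.reduce t0 y s η (Sum.inl j))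
    (fun j => (hy.regularity.memLp_space_apply (Sum.inl j) hs).integrable one_le_two) i
    (fun l hl => ae_restrict_of_forall_mem measurableSet_Ioo fun η hη => ?_) ξ
  have hl := hy.source_eq_neg_sum_reduce (fun j hj => hlow j (hj.trans hl)) hs hη.1.le
  rw [← neg_eq_iff_eq_neg.2 hl, ← sub_eq_add_neg]
  rfl

/-- The feedback is built from the resolvent at `ξ = 1`, so it prescribes exactly the value that
makes the reduced state vanish there. -/
theorem feedbackValue_eq_source (i : Fin m) {s : ℝ} (hs : t0 ≤ s) :
    S.feedbackValue s (y s) i = S.source (zeroTrace t0 y) i s 1 := by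
  induction i using WellFoundedLT.induction generalizing s with
  | ind i ih => exact (hy.source_eq_neg_sum_resolvent (fun j hj s => ih j hj) hs zero_le_one).symm

theorem eLpNorm_initial_sub_sourceState_le (hy0 : MemLp y0 2 (volume.restrict (Ioo 0 1))) {C : ℝ≥0}
    (hC : ∀ s i j ξ ζ, ‖S.resolvent s i j ξ ζ‖ ≤ C) :
    eLpNorm (fun x => y0 x - S.sourceState t0 y t0 x) 2 (volume.restrict (Ioo 0 1)) ≤
      (1 + (m + p : ℕ) * (m * C) : ℝ≥0) * eLpNorm y0 2 (volume.restrict (Ioo 0 1)) := by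
  have hsource (i : Fin m) (ξ : ℝ) (hξ : ξ ∈ Ioo (0 : ℝ) 1) :
      S.source (zeroTrace t0 y) i t0 ξ =
        -∑ j, ∫ η in Ioo 0 1, S.resolvent t0 i j ξ η * y0 η (Sum.inl j) := by
    rw [hy.source_eq_neg_sum_resolvent (fun j _ s => hy.feedbackValue_eq_source j) le_rfl hξ.1.le]
    congr 1
    refine Finset.sum_congr rfl fun j _ => integral_congr_ae ?_
    filter_upwards [hy.ae_initial_eq] with η hη
    rw [hη]
  have hbound := S.eLpNorm_sourceState_le (hC t0) hy0 hsource
  have hmeas := (S.continuous_sourceState_apply hy.regularity t0).aestronglyMeasurable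
    (μ := volume.restrict (Ioo 0 1))
  refine (eLpNorm_sub_le hy0.1 hmeas one_le_two).trans ?_
  rw [ENNReal.coe_add, add_mul, ENNReal.coe_one, one_mul]
  gcongr

theorem eLpNorm_le_reduce {s : ℝ} (hs : t0 ≤ s) :
    eLpNorm (y s) 2 (volume.restrict (Ioo 0 1)) ≤
      (1 + (m + p : ℕ) * (m * S.kernelBound) : ℝ≥0) *
        eLpNorm (S.reduce t0 y s) 2 (volume.restrict (Ioo 0 1)) := by
  have hreduce := (S.hasBroadRegularity_reduce hy.regularity).memLp_space s hs
  have hbound := S.eLpNorm_sourceState_le (S.norm_kernel_le s) hreduce fun i ξ hξ =>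
    hy.source_eq_neg_sum_reduce (fun j _ s => hy.feedbackValue_eq_source j) hs hξ.1.le
  have hmeas := (S.continuous_sourceState_apply hy.regularity s).aestronglyMeasurable
    (μ := volume.restrict (Ioo 0 1))
  calc eLpNorm (y s) 2 (volume.restrict (Ioo 0 1))
      = eLpNorm (S.reduce t0 y s + S.sourceState t0 y s) 2 (volume.restrict (Ioo 0 1)) := by
        congr 1
        exact (sub_add_cancel _ _).symm
    _ ≤ _ := eLpNorm_add_le hreduce.1 hmeas one_le_two
    _ ≤ _ := by
        rw [ENNReal.coe_add, add_mul, ENNReal.coe_one, one_mul]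
        gcongr

end IsClosedLoopSolution

end TraceCoupledSystem

/-! ### Broad solutions of the closed loop -/

namespace TraceCoupledSystem

variable {m p : ℕ} {S : TraceCoupledSystem m} {lam : ℝ → ℝ → Fin m ⊕ Fin p → ℝ}
  {G : ℝ → ℝ → Matrix (Fin m) (Fin m) ℝ} {H : ℝ → ℝ → Matrix (Fin p) (Fin m) ℝ}
  {F : ℝ → ℝ → Matrix (Fin m) (Fin m ⊕ Fin p) ℝ} {Q : ℝ → Matrix (Fin p) (Fin m) ℝ}
  {t0 : ℝ} {y0 : ℝ → HypState m p} {y : ℝ → ℝ → HypState m p}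

/-- The negative speeds and the coupling of `S` coincide with `lam` and `G` on the strip
`[0,+∞) × [0,1]`. -/
structure Extends (S : TraceCoupledSystem m) (lam : ℝ → ℝ → Fin m ⊕ Fin p → ℝ)
    (G : ℝ → ℝ → Matrix (Fin m) (Fin m) ℝ) : Prop where
  velocity_eq : ∀ i t x, 0 ≤ t → x ∈ Icc (0 : ℝ) 1 →
    (S.field i).velocity t x = lam t x (Sum.inl i)
  coupling_eq : ∀ i j t x, 0 ≤ t → x ∈ Icc (0 : ℝ) 1 → S.coupling i j t x = G t x i j

theorem exists_extends (hlam : ∀ i : Fin m, IsNegativeSpeed fun t x => lam t x (Sum.inl i))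
    (hG : IsBoundedContinuousMatrix G)
    (htri : ∀ t x : ℝ, 0 ≤ t → x ∈ Icc (0 : ℝ) 1 → ∀ i j : Fin m, i ≤ j → G t x i j = 0) :
    ∃ S : TraceCoupledSystem m, S.Extends lam G := by
  choose f hf using fun i => (hlam i).exists_negativeField
  choose C hC using fun i j => (hG i j).2
  set D : ℝ≥0 := Finset.univ.sup fun ij : Fin m × Fin m => (C ij.1 ij.2).toNNReal
  have hD (i j : Fin m) (t x : ℝ) (ht : 0 ≤ t) (hx : x ∈ Icc (0 : ℝ) 1) : ‖G t x i j‖ ≤ D :=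
    ((hC i j t x ht hx).trans (Real.le_coe_toNNReal _)).trans (NNReal.coe_le_coe.2
      (Finset.le_sup (f := fun ij : Fin m × Fin m => (C ij.1 ij.2).toNNReal)
        (Finset.mem_univ (i, j))))
  exact ⟨{  field := f
            coupling := fun i j => stripExtension fun t x => G t x i j
            bound := D
            continuous_coupling := fun i j => continuous_stripExtension (hG i j).1
            norm_coupling_le := fun i j => forall_stripExtension (P := fun v => ‖v‖ ≤ D) (hD i j)
            coupling_eq_zero := fun i j hij => forall_stripExtension (P := fun v => v = 0)
              fun t x ht hx => htri t x ht hx i j hij },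
    hf, fun i j _ _ => stripExtension_eq (g := fun t x => G t x i j)⟩

namespace Extends

variable (hS : S.Extends lam G)
include hS

theorem isBackwardCharacteristic_flow (i : Fin m) {t x : ℝ} (ht0 : 0 ≤ t0) (ht : t0 ≤ t)
    (hx : x ∈ Icc (0 : ℝ) 1) :
    IsBackwardCharacteristic (fun s z => lam s z (Sum.inl i))
      (entryPoint (Sum.inl i : Fin m ⊕ Fin p)) t0 t x (max t0 ((S.field i).hit 1 t x))
      fun s => (S.field i).flow s t x := by
  have hhit : (S.field i).hit 1 t x ≤ t := by
    rw [NegativeField.hit_le_iff, LipschitzField.flow_self]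
    exact hx.2
  have hinside : ∀ s ∈ Icc (max t0 ((S.field i).hit 1 t x)) t,
      (S.field i).flow s t x ∈ Icc (0 : ℝ) 1 := fun s hs => by
    have hzero : t ≤ (S.field i).hit 0 t x := by
      rw [NegativeField.le_hit_iff, LipschitzField.flow_self]
      exact hx.1
    exact ⟨(S.field i).le_hit_iff.1 (hs.2.trans hzero),
      (S.field i).hit_le_iff.1 ((le_max_right _ _).trans hs.1)⟩
  refine ⟨⟨le_max_left _ _, max_le ht hhit⟩, hinside, fun s hs => ?_,
    (S.field i).flow_self t x, ?_⟩
  · rw [← hS.velocity_eq i _ _ (ht0.trans ((le_max_left _ _).trans hs.1)) (hinside s hs)]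
    exact ((S.field i).isIntegralCurve_flow t x s).hasDerivWithinAt
  · refine (max_choice t0 ((S.field i).hit 1 t x)).imp_right fun h => ?_
    simp only [h, NegativeField.flow_hit, entryPoint]

theorem eq_flow (i : Fin m) {e t x s0 s : ℝ} {c : ℝ → ℝ} (ht0 : 0 ≤ t0)
    (hc : IsBackwardCharacteristic (fun s z => lam s z (Sum.inl i)) e t0 t x s0 c)
    (hs : s ∈ Icc s0 t) : c s = (S.field i).flow s t x := by
  rw [← hc.final]
  refine (S.field i).eq_flow (fun r hr => ?_) hs
  rw [hS.velocity_eq i _ _ (ht0.trans (hc.time_mem.1.trans hr.1)) (hc.inside r hr)]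
  exact hc.ode r hr

theorem sum_integral_fromBlocks_eq (hy : HasBroadRegularity t0 y) (i : Fin m) {e t x s0 : ℝ}
    {c : ℝ → ℝ} (ht0 : 0 ≤ t0)
    (hc : IsBackwardCharacteristic (fun s z => lam s z (Sum.inl i)) e t0 t x s0 c) :
    ∑ j, ∫ s in s0..t, Matrix.fromBlocks (G s (c s)) 0 (H s (c s)) 0 (Sum.inl i) j * y s 0 j =
      ∫ r in s0..t, S.forcing (zeroTrace t0 y) i t x r := by
  simp only [forcing]
  rw [intervalIntegral.integral_finsetSum fun j _ =>
    S.intervalIntegrable_coupling_mul (locallyIntegrable_zeroTrace hy) i j t x _ _]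
  simp only [Fintype.sum_sum_type, Matrix.fromBlocks_apply₁₁, Matrix.fromBlocks_apply₁₂,
    Matrix.zero_apply, zero_mul, intervalIntegral.integral_zero, Finset.sum_const_zero, add_zero]
  refine Finset.sum_congr rfl fun j _ => ?_
  rw [intervalIntegral.integral_of_le hc.time_mem.2, intervalIntegral.integral_of_le hc.time_mem.2]
  refine setIntegral_congr_fun measurableSet_Ioc fun s hs => ?_
  have hs0 : t0 < s := hc.time_mem.1.trans_lt hs.1
  have hsc : s ∈ Icc s0 t := Ioc_subset_Icc_self hs
  simp only [zeroTrace, indicator_of_mem (mem_Ioi.2 hs0), ← hS.eq_flow i ht0 hc hsc,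
    hS.coupling_eq i j s (c s) (ht0.trans hs0.le) (hc.inside s hsc)]

theorem ae_reduce_eq (ht0 : 0 ≤ t0)
    (hy : IsBroadSolution lam 0 (fun t x => Matrix.fromBlocks (G t x) 0 (H t x) 0) F Q t0 y0 y) :
    ∀ᵐ q ∂volume.restrict (Ioi t0 ×ˢ Ioo (0 : ℝ) 1), ∀ (i : Fin m) (s0 : ℝ) (c : ℝ → ℝ),
      IsBackwardCharacteristic (fun s z => lam s z (Sum.inl i))
        (entryPoint (Sum.inl i : Fin m ⊕ Fin p)) t0 q.1 q.2 s0 c →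
      S.reduce t0 y q.1 q.2 (Sum.inl i) =
        if t0 < s0 then boundaryValue F Q y s0 (Sum.inl i) - S.source (zeroTrace t0 y) i s0 1
        else (y0 (c t0) - S.sourceState t0 y t0 (c t0)) (Sum.inl i) := by
  filter_upwards [hy.equation] with q hq i s0 c hc
  have hflow : c s0 = (S.field i).flow s0 q.1 q.2 :=
    hS.eq_flow i ht0 hc (left_mem_Icc.2 hc.time_mem.2)
  have hsource : S.source (zeroTrace t0 y) i q.1 q.2 = S.source (zeroTrace t0 y) i s0 (c s0) +
      ∫ r in s0..q.1, S.forcing (zeroTrace t0 y) i q.1 q.2 r := by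
    rw [hflow, ← S.source_sub_source_flow (locallyIntegrable_zeroTrace hy.regularity)]
    ring
  have heq := hq (Sum.inl i) s0 c hc
  rw [hS.sum_integral_fromBlocks_eq hy.regularity i ht0 hc] at heq
  simp only [Pi.zero_apply, Matrix.zero_apply, zero_mul, intervalIntegral.integral_zero,
    Finset.sum_const_zero, add_zero] at heq
  have hreduce : S.reduce t0 y q.1 q.2 (Sum.inl i) =
      y q.1 q.2 (Sum.inl i) - S.source (zeroTrace t0 y) i q.1 q.2 := rfl
  rw [hreduce, heq, hsource, add_sub_add_right_eq_sub]
  split_ifs with h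
  · rw [show c s0 = 1 from hc.start.resolve_left h.ne']
  · rw [show s0 = t0 from le_antisymm (not_lt.1 h) hc.time_mem.1]
    rfl

theorem isClosedLoopSolution (ht0 : 0 ≤ t0)
    (hy : IsBroadSolution lam 0 (fun t x => Matrix.fromBlocks (G t x) 0 (H t x) 0) S.feedback Q
      t0 y0 y) :
    S.IsClosedLoopSolution t0 y0 y where
  regularity := hy.regularity
  transport := by
    filter_upwards [hS.ae_reduce_eq ht0 hy,
      ae_restrict_mem (measurableSet_Ioi.prod measurableSet_Ioo)] with q hq hmem i
    rw [hq i _ _ (hS.isBackwardCharacteristic_flow i ht0 hmem.1.le (Ioo_subset_Icc_self hmem.2)),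
      NegativeField.transport]
    simp only [lt_max_iff, lt_irrefl, false_or, boundaryValue_feedback]
    split_ifs with h
    · rw [max_eq_right h.le]
    · rfl

theorem isBroadSolution_reduce (ht0 : 0 ≤ t0)
    (hy : IsBroadSolution lam 0 (fun t x => Matrix.fromBlocks (G t x) 0 (H t x) 0) S.feedback Q
      t0 y0 y) :
    IsBroadSolution lam 0 (fun t x => Matrix.fromBlocks 0 0 (H t x) 0) 0 Q t0
      (fun x => y0 x - S.sourceState t0 y t0 x) (S.reduce t0 y) where
  regularity := S.hasBroadRegularity_reduce hy.regularity
  equation := by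
    filter_upwards [hy.equation, hS.ae_reduce_eq ht0 hy] with q hq hreduce
    rintro (i | k) s0 c hc
    · have hclosed := (hS.isClosedLoopSolution ht0 hy).feedbackValue_eq_source i hc.time_mem.1
      rw [hreduce i s0 c hc, boundaryValue_feedback, hclosed, sub_self]
      simp [boundaryValue, Matrix.fromBlocks]
    · have hinr : S.reduce t0 y q.1 q.2 (Sum.inr k) = y q.1 q.2 (Sum.inr k) := sub_zero _
      rw [hinr, hq (Sum.inr k) s0 c hc]
      simp [boundaryValue, reduce_zero, Matrix.fromBlocks]

end Extends

end TraceCoupledSystem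

theorem FiniteTimeStable.of_transform {m p : ℕ} {lam lam' : ℝ → ℝ → Fin m ⊕ Fin p → ℝ}
    {M M' G G' : ℝ → ℝ → Matrix (Fin m ⊕ Fin p) (Fin m ⊕ Fin p) ℝ}
    {F F' : ℝ → ℝ → Matrix (Fin m) (Fin m ⊕ Fin p) ℝ} {Q Q' : ℝ → Matrix (Fin p) (Fin m) ℝ}
    {T : ℝ} (h : FiniteTimeStable lam M G F Q T) (hT : 0 ≤ T) (C : ℝ≥0)
    (htransform : ∀ t0 y0 y, 0 ≤ t0 → MemLp y0 2 (volume.restrict (Ioo (0 : ℝ) 1)) →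
      IsBroadSolution lam' M' G' F' Q' t0 y0 y → ∃ z0 z,
        MemLp z0 2 (volume.restrict (Ioo (0 : ℝ) 1)) ∧ IsBroadSolution lam M G F Q t0 z0 z ∧
        eLpNorm z0 2 (volume.restrict (Ioo (0 : ℝ) 1)) ≤
          C * eLpNorm y0 2 (volume.restrict (Ioo (0 : ℝ) 1)) ∧
        ∀ t, t0 ≤ t → eLpNorm (y t) 2 (volume.restrict (Ioo (0 : ℝ) 1)) ≤
          C * eLpNorm (z t) 2 (volume.restrict (Ioo (0 : ℝ) 1))) :
    FiniteTimeStable lam' M' G' F' Q' T := by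
  obtain ⟨hattract, hstable⟩ := h
  refine ⟨fun t0 ht0 y0 hy0 y hy => ?_, fun ε hε => ?_⟩
  · obtain ⟨z0, z, hz0, hz, -, hyz⟩ := htransform t0 y0 y ht0 hy0 hy
    have hnorm := hyz (t0 + T) (le_add_of_nonneg_right hT)
    rw [eLpNorm_congr_ae (hattract t0 ht0 z0 hz0 z hz), eLpNorm_zero, mul_zero] at hnorm
    exact (eLpNorm_eq_zero_iff (hy.regularity.memLp_space _ (le_add_of_nonneg_right hT)).1
      two_ne_zero).1 (nonpos_iff_eq_zero.1 hnorm)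
  · have hscale (r : ℝ) (hr : 0 ≤ r) : C * ENNReal.ofReal (r / (C + 1)) ≤ ENNReal.ofReal r := by
      rw [← ENNReal.ofReal_coe_nnreal, ← ENNReal.ofReal_mul C.coe_nonneg]
      refine ENNReal.ofReal_le_ofReal ?_
      rw [mul_div_left_comm]
      exact mul_le_of_le_one_right hr (div_le_one_of_le₀ (by simp) (by positivity))
    obtain ⟨δ, hδ, hδε⟩ := hstable (ε / (C + 1)) (by positivity)
    refine ⟨δ / (C + 1), by positivity, fun t0 ht0 y0 hy0 hle y hy t ht => ?_⟩
    obtain ⟨z0, z, hz0, hz, hzy, hyz⟩ := htransform t0 y0 y ht0 hy0 hy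
    have hz0δ := (hzy.trans (mul_le_mul_right hle _)).trans (hscale δ hδ.le)
    exact ((hyz t ht).trans (mul_le_mul_right (hδε t0 ht0 z0 hz0 hz0δ z hz t ht) _)).trans
      (hscale ε hε.le)

theorem TraceCoupledSystem.Extends.finiteTimeStable {m p : ℕ} {S : TraceCoupledSystem m}
    {lam : ℝ → ℝ → Fin m ⊕ Fin p → ℝ} {G : ℝ → ℝ → Matrix (Fin m) (Fin m) ℝ}
    (hS : S.Extends lam G) {H : ℝ → ℝ → Matrix (Fin p) (Fin m) ℝ} {Q : ℝ → Matrix (Fin p) (Fin m) ℝ}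
    {T : ℝ} (hT : 0 ≤ T)
    (h : FiniteTimeStable lam 0 (fun t x => Matrix.fromBlocks 0 0 (H t x) 0) 0 Q T) :
    FiniteTimeStable lam 0 (fun t x => Matrix.fromBlocks (G t x) 0 (H t x) 0) S.feedback Q T := by
  obtain ⟨D, hD⟩ := S.exists_norm_resolvent_le
  refine h.of_transform hT
    (max (1 + (m + p : ℕ) * (m * D)) (1 + (m + p : ℕ) * (m * S.kernelBound)))
    fun t0 y0 y ht0 hy0 hy => ?_
  have hclosed := hS.isClosedLoopSolution ht0 hy
  refine ⟨_, S.reduce t0 y,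
    hy0.sub (memLp_Ioo_of_continuous (S.continuous_sourceState_apply hy.regularity t0)),
    hS.isBroadSolution_reduce ht0 hy, ?_, fun t ht => ?_⟩
  · refine (hclosed.eLpNorm_initial_sub_sourceState_le hy0 hD).trans (mul_le_mul_left ?_ _)
    exact ENNReal.coe_le_coe.2 (le_max_left _ _)
  · refine (hclosed.eLpNorm_le_reduce ht).trans (mul_le_mul_left ?_ _)
    exact ENNReal.coe_le_coe.2 (le_max_right _ _)

theorem proposition2p4_general {m p : ℕ} {lam : ℝ → ℝ → Fin m ⊕ Fin p → ℝ}
    (hlam : ∀ i : Fin m, IsNegativeSpeed fun t x => lam t x (Sum.inl i))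
    {G2mm : ℝ → ℝ → Matrix (Fin m) (Fin m) ℝ} (hG2mm : IsBoundedContinuousMatrix G2mm)
    (hG2tri : ∀ t x : ℝ, 0 ≤ t → x ∈ Icc (0 : ℝ) 1 → ∀ i j : Fin m, i ≤ j → G2mm t x i j = 0) :
    ∃ F2 : ℝ → ℝ → Matrix (Fin m) (Fin m ⊕ Fin p) ℝ, IsLInftyMatrix F2 ∧
      ∀ (Q1 : ℝ → Matrix (Fin p) (Fin m) ℝ) (G2pm : ℝ → ℝ → Matrix (Fin p) (Fin m) ℝ) (T : ℝ),
        0 ≤ T →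
        FiniteTimeStable lam 0 (fun t x => Matrix.fromBlocks 0 0 (G2pm t x) 0) 0 Q1 T →
        FiniteTimeStable lam 0 (fun t x => Matrix.fromBlocks (G2mm t x) 0 (G2pm t x) 0)
          F2 Q1 T := by
  obtain ⟨S, hS⟩ := TraceCoupledSystem.exists_extends hlam hG2mm hG2tri
  exact ⟨S.feedback, S.isLInftyMatrix_feedback, fun _ _ _ hT h => hS.finiteTimeStable hT h⟩

theorem proposition2p4 (m p : ℕ) (hm : 1 ≤ m) (hp : 1 ≤ p)
    (lam : ℝ → ℝ → Fin m ⊕ Fin p → ℝ) (hlam : AdmissibleSpeeds lam)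
    (Q1 : ℝ → Matrix (Fin p) (Fin m) ℝ) (hQ1 : IsBoundedContinuousMatrixTime Q1)
    (G2mm : ℝ → ℝ → Matrix (Fin m) (Fin m) ℝ) (hG2mm : IsBoundedContinuousMatrix G2mm)
    (hG2tri : ∀ t x : ℝ, 0 ≤ t → x ∈ Set.Icc (0 : ℝ) 1 →
      ∀ i j : Fin m, i ≤ j → G2mm t x i j = 0)
    (G2pm : ℝ → ℝ → Matrix (Fin p) (Fin m) ℝ) (hG2pm : IsBoundedContinuousMatrix G2pm) :
    ∃ F2 : ℝ → ℝ → Matrix (Fin m) (Fin m ⊕ Fin p) ℝ, IsLInftyMatrix F2 ∧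
      ∀ T : ℝ, 0 < T →
        FiniteTimeStable lam 0 (fun t x => Matrix.fromBlocks 0 0 (G2pm t x) 0) 0 Q1 T →
        FiniteTimeStable lam 0 (fun t x => Matrix.fromBlocks (G2mm t x) 0 (G2pm t x) 0) F2 Q1 T :=
  by
    obtain ⟨F2, hF2, hstable⟩ :=
      proposition2p4_general (p := p) hlam.isNegativeSpeed hG2mm hG2tri
    exact ⟨F2, hF2, fun T hT => hstable Q1 G2pm T hT.le⟩
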